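/- Let $\mathbb S^1=\mathbb R/T\mathbb Z$ ($T>0$) carry arc length $dx$; vector fields on $\mathbb S^1$ are identified with functions. Let $B:\mathbb S^1\to\mathbb R$ be Lipschitz continuous with $B>0$, and put $u_0:=\gamma/B$ with $\gamma:=\left(\int_{\mathbb S^1}\frac{dx}{B}\right)^{-1}$. Let $\varepsilon_0>0$, $m\ge 1$, and let $A=\{A_i^\varepsilon : 0\le i\le m,\ \varepsilon\in(0,\varepsilon_0)\}$ be vector fields on $\mathbb S^1$ in the one-dimensional admissible class, that is: (A1) there are $p>2$ and $C<\infty$ such that $A_0^\varepsilon\in L^p$, $A_i^\varepsilon\in W^{1,p}$ for $1\le i\le m$ (taken as continuous functions), and $\|A_0^\varepsilon\|_{p}+\max_{1\le i\le m}\|A_i^\varepsilon\|_{1,p}\le C$ for all $\varepsilon\in(0,\varepsilon_0)$; (A2) there is $c>0$ such that $\min_{\mathbb S^1}\sum_{i=1}^m|A_i^\varepsilon|^2\ge c$ for all $\varepsilon\in(0,\varepsilon_0)$. For each $\varepsilon\in(0,\varepsilon_0)$ let $\mu_\varepsilon$ be the stationary measure of the Stratonovich equation $$dX_t=B(X_t)\,dt+\varepsilon^2A_0^\varepsilon(X_t)\,dt+\varepsilon\sum_{i=1}^mA_i^\varepsilon(X_t)\circ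 dW_t^i ,$$ that is, the Borel probability measure on $\mathbb S^1$ with $A_0^\varepsilon,(A_i^\varepsilon)'\in L^1(\mu_\varepsilon)$ for $1\le i\le m$ and $$\int_{\mathbb S^1}\Big(\frac{\varepsilon^2}{2}\sum_{i=1}^mA_i^\varepsilon(A_i^\varepsilon f')'+\varepsilon^2A_0^\varepsilon f'+Bf'\Big)\,d\mu_\varepsilon=0\qquad\text{for all } f\in C^2(\mathbb S^1).$$ Then $\mu_\varepsilon$ has a continuous density $u_\varepsilon$ with respect to $dx$, $u_\varepsilon\in W^{1,2}(\mathbb S^1)$, and there are constants $0<c_1\le C_1<\infty$ independent of $\varepsilon$ such that, for all $\varepsilon\in(0,\varepsilon_0)$, $$\|u_\varepsilon\|_{1,2}\le C_1\qquad\text{and}\qquad c_1\le\min u_\varepsilon\le\max u_\varepsilon\le C_1 .$$ Moreover, as $\varepsilon\to0^+$, $u_\varepsilon\to u_0$ weakly in $W^{1,2}(\mathbb S^1)$ and strongly in $C^\alpha(\mathbb S^1)$ for every $\alpha\in(0,\tfrac12)$. -/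

import Mathlib

open MeasureTheory Set Filter Topology
open scoped NNReal ENNReal

noncomputable section

namespace Circle1D

/-- The derivative `f'` of a function on the circle `ℝ / Tℤ`, with respect to arc length. -/
def circleDeriv {T : ℝ} (f : AddCircle T → ℝ) (x : AddCircle T) : ℝ :=
  deriv (fun t : ℝ => f (x + (t : AddCircle T))) 0

/-- `f` is of class `C^n` on the circle `ℝ / Tℤ`: its `T`-periodic lift to `ℝ` is `C^n`. -/
def IsCn {T : ℝ} (n : ℕ∞) (f : AddCircle T → ℝ) : Prop :=
  ContDiff ℝ n (fun t : ℝ => f (t : AddCircle T))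

/-- `g` is a weak derivative of `f` on the circle: `∫ f φ' = - ∫ g φ` for all smooth `φ`. -/
structure HasWeakDeriv {T : ℝ} [Fact (0 < T)] (f g : AddCircle T → ℝ) : Prop where
  integrable_left : Integrable f volume
  integrable_right : Integrable g volume
  integral_eq : ∀ φ : AddCircle T → ℝ, IsCn (⊤ : ℕ∞) φ →
    ∫ x, f x * circleDeriv φ x = - ∫ x, g x * φ x

/-- Membership in the Sobolev space `W^{1,p}` of the circle. -/
def MemW1 {T : ℝ} [Fact (0 < T)] (p : ℝ≥0∞) (f : AddCircle T → ℝ) : Prop :=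
  MemLp f p volume ∧ ∃ g, HasWeakDeriv f g ∧ MemLp g p volume

/-- The Sobolev norm `‖f‖_{1,p} = ‖f‖_p + ‖f'‖_p`. Weak derivatives are unique almost everywhere,
so the infimum runs over a single value; it is `∞` if `f` has no weak derivative. -/
def w1Norm {T : ℝ} [Fact (0 < T)] (p : ℝ≥0∞) (f : AddCircle T → ℝ) : ℝ≥0∞ :=
  ⨅ (g : AddCircle T → ℝ) (_ : HasWeakDeriv f g), eLpNorm f p volume + eLpNorm g p volume

/-- The norm `‖f‖_{C^α} = sup |f| + sup_{x ≠ y} |f x - f y| / dist x y ^ α`. -/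
def cAlphaNorm {T : ℝ} (α : ℝ≥0) (f : AddCircle T → ℝ) : ℝ≥0∞ :=
  (⨆ x, ‖f x‖ₑ) + eHolderNorm α f

/-! ### Auxiliary facts needed to form the Hilbert space `W^{1,2}` -/

lemma IsCn.continuous {T : ℝ} {n : ℕ∞} {f : AddCircle T → ℝ} (hf : IsCn n f) :
    Continuous f :=
  (QuotientAddGroup.isQuotientMap_mk (AddSubgroup.zmultiples T)).continuous_iff.2
    (ContDiff.continuous hf)

lemma circleDeriv_coe {T : ℝ} (f : AddCircle T → ℝ) (s : ℝ) :
    circleDeriv f (s : AddCircle T) = deriv (fun t : ℝ => f (t : AddCircle T)) s := by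
  have h := deriv_comp_const_add (fun t : ℝ => f (t : AddCircle T)) s 0
  rw [add_zero] at h
  rw [← h]
  rfl

lemma IsCn.continuous_circleDeriv {T : ℝ} {n : ℕ∞} {f : AddCircle T → ℝ} (hf : IsCn n f)
    (hn : 1 ≤ n) : Continuous (circleDeriv f) := by
  refine (QuotientAddGroup.isQuotientMap_mk (AddSubgroup.zmultiples T)).continuous_iff.2 ?_
  have h := ContDiff.continuous_deriv hf (by exact_mod_cast hn)
  exact h.congr (fun s => (circleDeriv_coe f s).symm)

lemma integrable_mul_of_continuous {T : ℝ} [Fact (0 < T)] {f φ : AddCircle T → ℝ}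
    (hf : Integrable f volume) (hφ : Continuous φ) :
    Integrable (fun x => f x * φ x) volume := by
  obtain ⟨C, hC⟩ := isCompact_univ.exists_bound_of_continuousOn hφ.continuousOn
  simpa only [mul_comm] using
    hf.bdd_mul hφ.aestronglyMeasurable (Eventually.of_forall fun x => hC x (mem_univ x))

lemma HasWeakDeriv.congr {T : ℝ} [Fact (0 < T)] {f g f' g' : AddCircle T → ℝ}
    (h : HasWeakDeriv f g) (hf : f =ᵐ[volume] f') (hg : g =ᵐ[volume] g') :
    HasWeakDeriv f' g' where
  integrable_left := h.integrable_left.congr hf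
  integrable_right := h.integrable_right.congr hg
  integral_eq φ hφ := by
    have h1 : ∫ x, f' x * circleDeriv φ x = ∫ x, f x * circleDeriv φ x :=
      integral_congr_ae (hf.mono fun x hx => by simp only [hx])
    have h2 : ∫ x, g' x * φ x = ∫ x, g x * φ x :=
      integral_congr_ae (hg.mono fun x hx => by simp only [hx])
    rw [h1, h2, h.integral_eq φ hφ]

lemma HasWeakDeriv.zero {T : ℝ} [Fact (0 < T)] :
    HasWeakDeriv (0 : AddCircle T → ℝ) 0 where
  integrable_left := integrable_zero _ _ _
  integrable_right := integrable_zero _ _ _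
  integral_eq φ _ := by simp

lemma HasWeakDeriv.add {T : ℝ} [Fact (0 < T)] {f g f' g' : AddCircle T → ℝ}
    (h : HasWeakDeriv f g) (h' : HasWeakDeriv f' g') : HasWeakDeriv (f + f') (g + g') where
  integrable_left := h.integrable_left.add h'.integrable_left
  integrable_right := h.integrable_right.add h'.integrable_right
  integral_eq φ hφ := by
    have hc := hφ.continuous
    have hd := hφ.continuous_circleDeriv le_top
    simp only [Pi.add_apply, add_mul]
    rw [integral_add (integrable_mul_of_continuous h.integrable_left hd)
        (integrable_mul_of_continuous h'.integrable_left hd),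
      integral_add (integrable_mul_of_continuous h.integrable_right hc)
        (integrable_mul_of_continuous h'.integrable_right hc),
      h.integral_eq φ hφ, h'.integral_eq φ hφ]
    ring

lemma HasWeakDeriv.smul {T : ℝ} [Fact (0 < T)] {f g : AddCircle T → ℝ}
    (h : HasWeakDeriv f g) (c : ℝ) : HasWeakDeriv (c • f) (c • g) where
  integrable_left := h.integrable_left.smul c
  integrable_right := h.integrable_right.smul c
  integral_eq φ hφ := by
    simp only [Pi.smul_apply, smul_eq_mul, mul_assoc]
    rw [integral_const_mul, integral_const_mul, h.integral_eq φ hφ]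
    ring

/-- The Hilbert space `W^{1,2}` of the circle: pairs `(f, f')` in `L² × L²`, with the inner product
`⟨f, h⟩ = ∫ f h + ∫ f' h'`. -/
def W12 (T : ℝ) [Fact (0 < T)] :
    Submodule ℝ (WithLp 2 (Lp ℝ 2 (volume : Measure (AddCircle T)) ×
      Lp ℝ 2 (volume : Measure (AddCircle T)))) where
  carrier := {w | HasWeakDeriv (w.fst : AddCircle T → ℝ) (w.snd : AddCircle T → ℝ)}
  add_mem' {v w} hv hw :=
    (HasWeakDeriv.add hv hw).congr (Lp.coeFn_add v.fst w.fst).symm (Lp.coeFn_add v.snd w.snd).symm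
  zero_mem' := HasWeakDeriv.zero.congr (Lp.coeFn_zero _ _ _).symm (Lp.coeFn_zero _ _ _).symm
  smul_mem' c w hw :=
    (HasWeakDeriv.smul hw c).congr (Lp.coeFn_smul c w.fst).symm (Lp.coeFn_smul c w.snd).symm

/-- `u` and `u₀` belong to `W^{1,2}` (`u ε` for `ε` eventually along the filter `l`), and
`u ε → u₀` along `l` in the weak topology of the Hilbert space `W^{1,2}`. -/
def TendstoWeaklyW12 {T : ℝ} [Fact (0 < T)] (u : ℝ → AddCircle T → ℝ) (l : Filter ℝ)
    (u₀ : AddCircle T → ℝ) : Prop :=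
  ∃ (U : ℝ → W12 T) (U₀ : W12 T),
    (∀ᶠ ε in l, ((U ε).1.fst : AddCircle T → ℝ) =ᵐ[volume] u ε) ∧
    (U₀.1.fst : AddCircle T → ℝ) =ᵐ[volume] u₀ ∧
    Tendsto (fun ε => toWeakSpace ℝ (W12 T) (U ε)) l (𝓝 (toWeakSpace ℝ (W12 T) U₀))

/-! ### The noise and the stationary measures -/

/-- The one-dimensional admissible class, for noise intensities `ε ∈ (0, ε₀)`. The collection is
`A ε 0, …, A ε m`, vector fields on the circle being identified with functions. The fields
`A ε 1, …, A ε m` lie in `W^{1,p}` with `p > 2`, hence have a continuous representative, which is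
the function taken here. -/
structure Admissible {T : ℝ} [Fact (0 < T)] (ε₀ : ℝ) {m : ℕ}
    (A : ℝ → Fin (m + 1) → AddCircle T → ℝ) : Prop where
  continuous : ∀ ε ∈ Ioo 0 ε₀, ∀ i : Fin m, Continuous (A ε i.succ)
  regular : ∃ p : ℝ≥0∞, 2 < p ∧
    (∀ ε ∈ Ioo 0 ε₀, MemLp (A ε 0) p volume ∧ ∀ i : Fin m, MemW1 p (A ε i.succ)) ∧
    ∃ C : ℝ≥0, ∀ ε ∈ Ioo 0 ε₀,
      eLpNorm (A ε 0) p volume + ⨆ i : Fin m, w1Norm p (A ε i.succ) ≤ C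
  nondegenerate : ∃ c : ℝ, 0 < c ∧ ∀ ε ∈ Ioo 0 ε₀, ∀ x, c ≤ ∑ i : Fin m, |A ε i.succ x| ^ 2

/-- The generator `f ↦ (ε² / 2) ∑ Aᵢ (Aᵢ f')' + ε² A₀ f' + B f'` of the Stratonovich equation
`dX = B(X) dt + ε² A₀(X) dt + ε ∑ Aᵢ(X) ∘ dWⁱ`; here `dA i` stands for the weak derivative of
the field `Aᵢ`, so that `(Aᵢ f')' = Aᵢ f'' + Aᵢ' f'`. -/
def generator {T : ℝ} {m : ℕ} (B : AddCircle T → ℝ) (A : Fin (m + 1) → AddCircle T → ℝ)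
    (dA : Fin m → AddCircle T → ℝ) (ε : ℝ) (f : AddCircle T → ℝ) (x : AddCircle T) : ℝ :=
  ε ^ 2 / 2 * ∑ i : Fin m, A i.succ x *
      (A i.succ x * circleDeriv (circleDeriv f) x + dA i x * circleDeriv f x)
    + ε ^ 2 * A 0 x * circleDeriv f x + B x * circleDeriv f x

/-- `μ` is a stationary measure: a probability measure with `A₀, A₁', …, Aₘ' ∈ L¹(μ)` and
`∫ 𝓛 f dμ = 0` for all `f ∈ C²`. As `Aᵢ'` is only defined almost everywhere, this is required for
some representative of it. -/
def IsStationaryMeasure {T : ℝ} [Fact (0 < T)] {m : ℕ} (B : AddCircle T → ℝ)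
    (A : Fin (m + 1) → AddCircle T → ℝ) (ε : ℝ) (μ : Measure (AddCircle T)) : Prop :=
  IsProbabilityMeasure μ ∧ ∃ dA : Fin m → AddCircle T → ℝ,
    (∀ i, HasWeakDeriv (A i.succ) (dA i)) ∧
    Integrable (A 0) μ ∧ (∀ i, Integrable (dA i) μ) ∧
    ∀ f : AddCircle T → ℝ, IsCn 2 f → ∫ x, generator B A dA ε f x ∂μ = 0

end Circle1D

end

/-! Write `a = ½ ∑ Aᵢ²` and `β = ½ ∑ Aᵢ Aᵢ' - A₀`. Every mean-zero smooth function on the circle is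
a derivative, so stationarity says that `μ` annihilates `ε² a φ' + b φ` for all such `φ`, where `b`
is the full first-order coefficient. Fubini turns the term with `b` into an integral of `φ'` against
an `L¹` function. Hence `μ` is absolutely continuous, and its density `u` solves the once integrated
Fokker-Planck equation `ε² (a u' + β u) = B u - κ` with a constant `κ` (`exists_densityEquation`).

The central step is to multiply this equation by `(B u)'`. The right side becomes `(B u - κ)(B u -
κ)'`, which integrates to zero over the circle, so `ε` drops out. Since `a B` is bounded below, this
leaves `∫ u'² ≤ C (max u)²` with `C` independent of `ε` (`DensityEquation.integral_du_sq_le`). Such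
a bound prevents `u` from falling quickly away from its maximum, and unit mass then bounds `max u`
(`DensityEquation.u_le`). The `W^{1,2}` bound follows.

By the equation, the flux `B u - κ` is `O(ε²)` in `L²`, while its derivative is bounded in `L²`.
Interpolation gives `O(ε)` uniformly (`DensityEquation.flux_sq_le`), and unit mass identifies `κ` up
to `O(ε)`, so `|u - u₀| ≤ C ε` (`DensityEquation.abs_sub_limit_le`). The lower bound on `u` comes
from this rate for small `ε` and from a Harnack inequality for the remaining `ε`
(`DensityEquation.harnack`). Interpolating the uniform rate with the Hölder-1/2 bound gives
convergence in `C^α`. Boundedness in `W^{1,2}` together with strong `L²` convergence gives weak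
convergence (`tendstoWeaklyW12_of_bounded`). -/

noncomputable section

namespace Circle1D

variable {T : ℝ} [Fact (0 < T)]

/-! ### Lifts to the real line -/

lemma measurable_of_lift {g : AddCircle T → ℝ} (h : Measurable fun t : ℝ => g t) :
    Measurable g := by
  have h1 : Measurable fun x : AddCircle T => ((AddCircle.equivIoc T 0 x : ℝ)) :=
    measurable_subtype_coe.comp (AddCircle.measurableEquivIoc T 0).measurable
  have h2 := h.comp h1
  have h3 : g = (fun t : ℝ => g t) ∘ fun x : AddCircle T => (AddCircle.equivIoc T 0 x : ℝ) := by
    funext x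
    simp [AddCircle.coe_equivIoc]
  rwa [h3]

lemma integrable_lift {f : AddCircle T → ℝ} (hf : Integrable f volume) (t : ℝ) :
    Integrable (fun s : ℝ => f s) (volume.restrict (Ioc t (t + T))) :=
  ((AddCircle.measurePreserving_mk T t).integrable_comp hf.aestronglyMeasurable).2 hf

lemma intervalIntegrable_lift {f : AddCircle T → ℝ} (hf : Integrable f volume) (x y : ℝ) :
    IntervalIntegrable (fun t : ℝ => f t) volume x y := by
  have hT : (0 : ℝ) < T := Fact.out
  refine Function.Periodic.intervalIntegrable (T := T) (t := 0) (fun t => ?_) hT.ne' ?_ x y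
  · simp
  · rw [intervalIntegrable_iff_integrableOn_Ioc_of_le (by linarith)]
    exact integrable_lift hf 0

lemma locallyIntegrable_lift {f : AddCircle T → ℝ} (hf : Integrable f volume) :
    LocallyIntegrable (fun t : ℝ => f t) volume := by
  rw [locallyIntegrable_iff]
  intro k hk
  obtain ⟨a, ha⟩ := hk.bddBelow
  obtain ⟨b, hb⟩ := hk.bddAbove
  rcases le_total a b with h | h
  · refine IntegrableOn.mono_set (t := Icc a b) ?_ fun x hx => ⟨ha hx, hb hx⟩
    rw [integrableOn_Icc_iff_integrableOn_Ioc]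
    exact (intervalIntegrable_iff_integrableOn_Ioc_of_le h).1 (intervalIntegrable_lift hf a b)
  · refine IntegrableOn.mono_set (t := {a}) ?_ fun x hx => ?_
    · simp
    · exact le_antisymm ((hb hx).trans h) (ha hx)

lemma intervalIntegral_le_integral {f : AddCircle T → ℝ} (hf : Integrable f volume)
    (h0 : ∀ x, 0 ≤ f x) {x y : ℝ} (hxy : x ≤ y) (hy : y ≤ x + T) :
    ∫ t in x..y, f t ≤ ∫ z, f z := by
  rw [← AddCircle.intervalIntegral_preimage T x f]
  exact intervalIntegral.integral_mono_interval le_rfl hxy hy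
    (Eventually.of_forall fun t => h0 t) (intervalIntegrable_lift hf _ _)

/-- The two points are joined by a positively oriented arc, in this order. The fixed orientation is
what lets one-sided bounds on a derivative suffice later. -/
lemma exists_coe_le (x y : AddCircle T) :
    ∃ s t : ℝ, (s : AddCircle T) = x ∧ (t : AddCircle T) = y ∧ s ≤ t ∧ t ≤ s + T := by
  obtain ⟨s, rfl⟩ := QuotientAddGroup.mk_surjective x
  refine ⟨s, AddCircle.equivIoc T s y, rfl, AddCircle.coe_equivIoc, ?_, ?_⟩
  · exact (AddCircle.equivIoc T s y).2.1.le
  · exact (AddCircle.equivIoc T s y).2.2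

lemma exists_coe_dist {T : ℝ} (x y : AddCircle T) :
    ∃ s t : ℝ, (s : AddCircle T) = x ∧ (t : AddCircle T) = y ∧ |t - s| = dist x y := by
  obtain ⟨s, rfl⟩ := QuotientAddGroup.mk_surjective x
  obtain ⟨t, rfl⟩ := QuotientAddGroup.mk_surjective y
  refine ⟨s, t - round (T⁻¹ * (t - s)) * T, rfl, ?_, ?_⟩
  · rw [AddCircle.coe_sub]
    have : ((round (T⁻¹ * (t - s)) * T : ℝ) : AddCircle T) = 0 := by
      rw [AddCircle.coe_eq_zero_iff]
      exact ⟨round (T⁻¹ * (t - s)), by simp⟩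
    rw [this, sub_zero]
  · rw [dist_comm, dist_eq_norm]
    have := AddCircle.norm_eq T (x := t - s)
    rw [AddCircle.coe_sub] at this
    refine Eq.trans ?_ this.symm
    congr 1
    ring

lemma dist_le_half (x y : AddCircle T) : dist x y ≤ T / 2 := by
  have hT : (0 : ℝ) < T := Fact.out
  rw [dist_eq_norm]
  simpa [abs_of_pos hT] using AddCircle.norm_le_half_period T hT.ne' (x := x - y)

/-- The Lipschitz condition is only asked on a set containing the values, since the inverse and the
logarithm are Lipschitz only away from `0`. -/
lemma _root_.AbsolutelyContinuousOnInterval.lipschitz_comp {f : ℝ → ℝ} {a b : ℝ}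
    (hf : AbsolutelyContinuousOnInterval f a b) {Φ : ℝ → ℝ} {s : Set ℝ} {K : ℝ≥0}
    (hΦ : LipschitzOnWith K Φ s) (hs : ∀ t, f t ∈ s) :
    AbsolutelyContinuousOnInterval (fun t => Φ (f t)) a b := by
  unfold AbsolutelyContinuousOnInterval at *
  refine squeeze_zero (fun _ => Finset.sum_nonneg fun _ _ => dist_nonneg) (fun E => ?_)
    (by simpa using hf.const_mul (K : ℝ))
  rw [Finset.mul_sum]
  exact Finset.sum_le_sum fun i _ => hΦ.dist_le_mul _ (hs _) _ (hs _)

/-! ### Absolutely continuous functions on the circle -/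

/-- `F` is an indefinite integral on the circle of the integrable function `f`; equivalently, `F`
is absolutely continuous with almost everywhere derivative `f`. -/
structure IsPrimitive (F f : AddCircle T → ℝ) : Prop where
  integrable : Integrable f volume
  sub_eq : ∀ x y : ℝ, F y - F x = ∫ t in x..y, f t

namespace IsPrimitive

variable {F G f g : AddCircle T → ℝ}

lemma lift_eq (h : IsPrimitive F f) :
    (fun t : ℝ => F t) = fun t : ℝ => F (0 : ℝ) + ∫ s in (0 : ℝ)..t, f s := by
  ext t
  rw [← h.sub_eq 0 t]
  ring

lemma ae_hasDerivAt (h : IsPrimitive F f) :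
    ∀ᵐ t : ℝ, HasDerivAt (fun t : ℝ => F t) (f t) t := by
  filter_upwards [LocallyIntegrable.ae_hasDerivAt_integral (locallyIntegrable_lift h.integrable)] with t ht
  rw [h.lift_eq]
  exact (ht 0).const_add _

lemma absolutelyContinuous (h : IsPrimitive F f) (a b : ℝ) :
    AbsolutelyContinuousOnInterval (fun t : ℝ => F t) a b := by
  have h1 := (intervalIntegrable_lift h.integrable a b).absolutelyContinuousOnInterval_intervalIntegral
    (c := a) left_mem_uIcc
  have h2 : AbsolutelyContinuousOnInterval (fun _ : ℝ => F a) a b :=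
    (LipschitzWith.const (F a)).lipschitzOnWith.absolutelyContinuousOnInterval (K := 0)
  have h3 := h2.add h1
  have e : (fun t : ℝ => F t) = fun t : ℝ => F a + ∫ v in a..t, f v := by
    funext t
    rw [← h.sub_eq a t]
    ring
  rw [e]
  exact h3

lemma of_absolutelyContinuous (hF : ∀ a b, AbsolutelyContinuousOnInterval (fun t : ℝ => F t) a b)
    (hf : Integrable f volume) (h : ∀ᵐ t : ℝ, HasDerivAt (fun t : ℝ => F t) (f t) t) :
    IsPrimitive F f where
  integrable := hf
  sub_eq x y := by
    rw [← (hF x y).integral_deriv_eq_sub]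
    refine intervalIntegral.integral_congr_ae ?_
    filter_upwards [h] with t ht _
    exact ht.deriv

protected lemma continuous (h : IsPrimitive F f) : Continuous F := by
  refine (QuotientAddGroup.isQuotientMap_mk (AddSubgroup.zmultiples T)).continuous_iff.2 ?_
  have h1 : Continuous fun t : ℝ => F t := by
    rw [h.lift_eq]
    exact continuous_const.add
      (intervalIntegral.continuous_primitive (intervalIntegrable_lift h.integrable) 0)
  exact h1

/-- The null set lives on the circle and has to be transferred to the line. Any interval is covered
by finitely many full periods, so `|f - g|` integrates to zero on it. Thus `0` is a primitive of `f
- g`, and differentiating almost everywhere gives `f = g` almost everywhere on the line. -/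
lemma congr_ae (h : IsPrimitive F f) (hfg : f =ᵐ[volume] g) : IsPrimitive F g := by
  have hg := h.integrable.congr hfg
  refine .of_absolutelyContinuous h.absolutelyContinuous hg ?_
  have h0 : IsPrimitive (0 : AddCircle T → ℝ) (fun x => f x - g x) := by
    refine ⟨h.integrable.sub hg, fun x y => ?_⟩
    have key : ∀ z w : ℝ, ∫ t in z..w, |f t - g t| = 0 := by
      have hper : Function.Periodic (fun t : ℝ => |f t - g t|) T := fun t => by simp
      have hI := intervalIntegrable_lift (f := fun x => |f x - g x|) (h.integrable.sub hg).abs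
      have hz : ∀ z, ∫ t in z..z + T, |f t - g t| = 0 := fun z => by
        rw [AddCircle.intervalIntegral_preimage T z (fun x => |f x - g x|)]
        refine integral_eq_zero_of_ae ?_
        filter_upwards [hfg] with x hx
        simp [hx]
      have hle : ∀ z w, z ≤ w → ∫ t in z..w, |f t - g t| = 0 := by
        intro z w hzw
        have hT : (0 : ℝ) < T := Fact.out
        obtain ⟨n, hn⟩ := exists_nat_ge ((w - z) / T)
        have hn' : w ≤ z + n • T := by
          rw [div_le_iff₀ hT] at hn
          simp only [nsmul_eq_mul]
          linarith
        have h1 : ∫ t in z..z + n • T, |f t - g t| = 0 := by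
          have := hper.intervalIntegral_add_zsmul_eq n z hI
          rw [hz] at this
          simpa using this
        refine le_antisymm ?_ (intervalIntegral.integral_nonneg hzw fun _ _ => abs_nonneg _)
        rw [← h1]
        exact intervalIntegral.integral_mono_interval le_rfl hzw hn'
          (Eventually.of_forall fun t => abs_nonneg _) (hI _ _)
      intro z w
      rcases le_total z w with hzw | hzw
      · exact hle z w hzw
      · rw [intervalIntegral.integral_symm, hle w z hzw, neg_zero]
    simp only [Pi.zero_apply, sub_zero]
    symm
    rcases le_total x y with hxy | hxy
    · exact abs_eq_zero.1 (le_antisymm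
        ((intervalIntegral.abs_integral_le_integral_abs hxy).trans (key x y).le) (abs_nonneg _))
    · rw [intervalIntegral.integral_symm, neg_eq_zero]
      exact abs_eq_zero.1 (le_antisymm
        ((intervalIntegral.abs_integral_le_integral_abs hxy).trans (key y x).le) (abs_nonneg _))
  filter_upwards [h.ae_hasDerivAt, h0.ae_hasDerivAt] with t h1 h2
  have : f t - g t = 0 := h2.unique (hasDerivAt_const t (0 : ℝ))
  rwa [← sub_eq_zero.1 this]

lemma mul (hF : IsPrimitive F f) (hG : IsPrimitive G g) :
    IsPrimitive (fun x => F x * G x) (fun x => f x * G x + F x * g x) := by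
  refine .of_absolutelyContinuous
    (fun a b => (hF.absolutelyContinuous a b).mul (hG.absolutelyContinuous a b)) ?_ ?_
  · refine (integrable_mul_of_continuous hF.integrable hG.continuous).add ?_
    simpa only [mul_comm] using integrable_mul_of_continuous hG.integrable hF.continuous
  · filter_upwards [hF.ae_hasDerivAt, hG.ae_hasDerivAt] with t h1 h2
    exact h1.mul h2

lemma add (hF : IsPrimitive F f) (hG : IsPrimitive G g) :
    IsPrimitive (fun x => F x + G x) (fun x => f x + g x) := by
  refine ⟨hF.integrable.add hG.integrable, fun x y => ?_⟩
  rw [intervalIntegral.integral_add (intervalIntegrable_lift hF.integrable _ _)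
    (intervalIntegrable_lift hG.integrable _ _), ← hF.sub_eq, ← hG.sub_eq]
  ring

lemma const (c : ℝ) : IsPrimitive (fun _ : AddCircle T => c) (fun _ => 0) :=
  ⟨integrable_zero _ _ _, fun x y => by simp⟩

lemma const_mul (c : ℝ) (hF : IsPrimitive F f) :
    IsPrimitive (fun x => c * F x) (fun x => c * f x) := by
  refine ⟨hF.integrable.const_mul c, fun x y => ?_⟩
  rw [intervalIntegral.integral_const_mul, ← hF.sub_eq]
  ring

lemma sub (hF : IsPrimitive F f) (hG : IsPrimitive G g) :
    IsPrimitive (fun x => F x - G x) (fun x => f x - g x) := by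
  simpa [sub_eq_add_neg] using hF.add (hG.const_mul (-1))

lemma sum {ι : Type*} (s : Finset ι) {F f : ι → AddCircle T → ℝ}
    (h : ∀ i ∈ s, IsPrimitive (F i) (f i)) :
    IsPrimitive (fun x => ∑ i ∈ s, F i x) (fun x => ∑ i ∈ s, f i x) := by
  classical
  induction s using Finset.induction_on with
  | empty => simpa using const (T := T) 0
  | insert a s ha ih =>
    simp only [Finset.sum_insert ha]
    exact (h a (Finset.mem_insert_self a s)).add
      (ih fun i hi => h i (Finset.mem_insert_of_mem hi))

lemma comp {Φ Φ' : ℝ → ℝ} {s : Set ℝ} {K : ℝ≥0} (hF : IsPrimitive F f)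
    (hs : ∀ x, F x ∈ s) (hK : LipschitzOnWith K Φ s) (hΦ : ∀ y ∈ s, HasDerivAt Φ (Φ' y) y)
    (hc : ContinuousOn Φ' s) :
    IsPrimitive (fun x => Φ (F x)) (fun x => Φ' (F x) * f x) := by
  refine .of_absolutelyContinuous
    (fun a b => (hF.absolutelyContinuous a b).lipschitz_comp hK fun t => hs _) ?_ ?_
  · have : Continuous fun x => Φ' (F x) := hc.comp_continuous hF.continuous hs
    simpa only [mul_comm] using integrable_mul_of_continuous hF.integrable this
  · filter_upwards [hF.ae_hasDerivAt] with t ht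
    exact HasDerivAt.comp t (hΦ _ (hs t)) ht

lemma inv {c : ℝ} (hc : 0 < c) (hF : IsPrimitive F f) (h : ∀ x, c ≤ F x) :
    IsPrimitive (fun x => (F x)⁻¹) (fun x => -(F x ^ 2)⁻¹ * f x) := by
  have hd : ∀ y ∈ Ici c, HasDerivAt (fun y : ℝ => y⁻¹) (-(y ^ 2)⁻¹) y := fun y hy =>
    hasDerivAt_inv (hc.trans_le hy).ne'
  refine hF.comp (s := Ici c) (K := Real.toNNReal (c ^ 2)⁻¹) (Φ := fun y => y⁻¹)
    (Φ' := fun y => -(y ^ 2)⁻¹) h ?_ hd ?_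
  · refine (convex_Ici c).lipschitzOnWith_of_nnnorm_hasDerivWithin_le
      (fun y hy => (hd y hy).hasDerivWithinAt) fun y hy => ?_
    rw [← NNReal.coe_le_coe, Real.coe_toNNReal _ (by positivity)]
    have hy' : c ≤ y := hy
    have : 0 < y := hc.trans_le hy'
    simp only [coe_nnnorm, norm_neg, norm_inv, norm_pow, Real.norm_eq_abs,
      abs_of_pos this]
    gcongr
  · refine ContinuousOn.neg (ContinuousOn.inv₀ (by fun_prop) fun y hy => ?_)
    have : 0 < y := hc.trans_le hy
    positivity

lemma log {c : ℝ} (hc : 0 < c) (hF : IsPrimitive F f) (h : ∀ x, c ≤ F x) :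
    IsPrimitive (fun x => Real.log (F x)) (fun x => (F x)⁻¹ * f x) := by
  have hd : ∀ y ∈ Ici c, HasDerivAt Real.log y⁻¹ y := fun y hy =>
    Real.hasDerivAt_log (hc.trans_le hy).ne'
  refine hF.comp (s := Ici c) (K := Real.toNNReal c⁻¹) (Φ := Real.log)
    (Φ' := fun y => y⁻¹) h ?_ hd ?_
  · refine (convex_Ici c).lipschitzOnWith_of_nnnorm_hasDerivWithin_le
      (fun y hy => (hd y hy).hasDerivWithinAt) fun y hy => ?_
    rw [← NNReal.coe_le_coe, Real.coe_toNNReal _ (by positivity)]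
    have hy' : c ≤ y := hy
    have : 0 < y := hc.trans_le hy'
    simp only [coe_nnnorm, norm_inv, Real.norm_eq_abs, abs_of_pos this]
    gcongr
  · exact ContinuousOn.inv₀ continuousOn_id fun y hy => (hc.trans_le hy).ne'

lemma integral_eq_zero (h : IsPrimitive F f) : ∫ x, f x = 0 := by
  rw [← AddCircle.intervalIntegral_preimage T 0 f, ← h.sub_eq, AddCircle.coe_add_period,
    sub_self]

lemma of_isCn {n : ℕ∞} (hF : IsCn n F) (hn : 1 ≤ n) : IsPrimitive F (circleDeriv F) := by
  have hc := hF.continuous_circleDeriv hn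
  have hd : ∀ t : ℝ, HasDerivAt (fun t : ℝ => F t) (circleDeriv F t) t := fun t => by
    rw [circleDeriv_coe]
    refine (ContDiff.differentiable hF ?_ t).hasDerivAt
    intro h
    simp only [WithTop.coe_eq_zero] at h
    simp [h] at hn
  have hI : Integrable (circleDeriv F) volume :=
    hc.integrable_of_hasCompactSupport (HasCompactSupport.of_compactSpace _)
  refine ⟨hI, fun x y => ?_⟩
  rw [intervalIntegral.integral_eq_sub_of_hasDerivAt (fun t _ => hd t)
    (intervalIntegrable_lift hI x y)]

/-- Rademacher's theorem. Since `deriv` is `0` at points of non-differentiability, the bound on the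
derivative holds at every point. -/
lemma of_lipschitzWith {K : ℝ≥0} (hF : LipschitzWith K F) :
    Measurable (circleDeriv F) ∧ (∀ x, |circleDeriv F x| ≤ K) ∧ IsPrimitive F (circleDeriv F) := by
  have hL : LipschitzWith K (fun t : ℝ => F t) := by
    refine LipschitzWith.of_dist_le_mul fun x y => (hF.dist_le_mul _ _).trans ?_
    gcongr
    rw [dist_eq_norm, dist_eq_norm, ← AddCircle.coe_sub]
    exact QuotientAddGroup.norm_mk_le_norm
  have hm : Measurable (circleDeriv F) := by
    refine measurable_of_lift ?_
    simp only [circleDeriv_coe]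
    exact measurable_deriv _
  have hb : ∀ x, |circleDeriv F x| ≤ K := by
    intro x
    obtain ⟨s, rfl⟩ := QuotientAddGroup.mk_surjective x
    have := norm_deriv_le_of_lipschitz (x₀ := s) hL
    rw [← circleDeriv_coe] at this
    exact this
  refine ⟨hm, hb, .of_absolutelyContinuous
    (fun a b => hL.lipschitzOnWith.absolutelyContinuousOnInterval) ?_ ?_⟩
  · exact Integrable.of_bound hm.aestronglyMeasurable K (Eventually.of_forall hb)
  · filter_upwards [hL.ae_differentiableAt] with t ht
    rw [circleDeriv_coe]
    exact ht.hasDerivAt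

lemma hasWeakDeriv (h : IsPrimitive F f) : HasWeakDeriv F f where
  integrable_left :=
    h.continuous.integrable_of_hasCompactSupport (HasCompactSupport.of_compactSpace _)
  integrable_right := h.integrable
  integral_eq φ hφ := by
    have hp := h.mul (.of_isCn hφ le_top)
    have h0 := hp.integral_eq_zero
    have h1 := integrable_mul_of_continuous h.integrable hφ.continuous
    have h2 := integrable_mul_of_continuous
      (h.continuous.integrable_of_hasCompactSupport (HasCompactSupport.of_compactSpace _))
      (hφ.continuous_circleDeriv le_top)
    rw [integral_add h1 h2] at h0
    linarith

lemma abs_sub_le (h : IsPrimitive F f) (x y : AddCircle T) : |F y - F x| ≤ ∫ z, |f z| := by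
  obtain ⟨s, t, rfl, rfl, hst, hts⟩ := exists_coe_le x y
  rw [h.sub_eq]
  exact (intervalIntegral.abs_integral_le_integral_abs hst).trans
    (intervalIntegral_le_integral h.integrable.abs (fun _ => abs_nonneg _) hst hts)

/-- An upper bound for `f` alone suffices because `y` is reached from `x` in the positive direction;
non-negativity of `g` then allows enlarging the arc to the whole circle. -/
lemma sub_le_of_le (h : IsPrimitive F f) (hg : Integrable g volume) (hg0 : ∀ x, 0 ≤ g x)
    (hfg : ∀ x, f x ≤ g x) (x y : AddCircle T) : F y - F x ≤ ∫ z, g z := by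
  obtain ⟨s, t, rfl, rfl, hst, hts⟩ := exists_coe_le x y
  rw [h.sub_eq]
  exact (intervalIntegral.integral_mono_on hst (intervalIntegrable_lift h.integrable _ _)
    (intervalIntegrable_lift hg _ _) fun t _ => hfg t).trans
    (intervalIntegral_le_integral hg hg0 hst hts)

lemma sq_sub_le (h : IsPrimitive F f) (hf : Integrable (fun x => f x ^ 2) volume) {s t : ℝ}
    (hst : s ≤ t) (hts : t ≤ s + T) : (F t - F s) ^ 2 ≤ (t - s) * ∫ x, f x ^ 2 := by
  have hY : ∀ l : ℝ, 0 < l → 2 * |F t - F s| ≤ l * (t - s) + (∫ x, f x ^ 2) / l := by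
    intro l hl
    have h1 : ∫ r in s..t, 2 * |f r| ≤ ∫ r in s..t, (l + f r ^ 2 / l) := by
      refine intervalIntegral.integral_mono_on hst ?_ ?_ fun r _ => ?_
      · exact (intervalIntegrable_lift h.integrable.abs s t).const_mul 2
      · exact intervalIntegrable_const.add ((intervalIntegrable_lift hf s t).div_const l)
      · have : 0 ≤ (l - |f r|) ^ 2 / l := by positivity
        have h2 : (l - |f r|) ^ 2 / l = l + f r ^ 2 / l - 2 * |f r| := by
          rw [← sq_abs (f r)]
          field_simp
          ring
        linarith
    rw [intervalIntegral.integral_const_mul, intervalIntegral.integral_add intervalIntegrable_const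
      ((intervalIntegrable_lift hf s t).div_const l), intervalIntegral.integral_div,
      intervalIntegral.integral_const, smul_eq_mul] at h1
    have h3 := intervalIntegral_le_integral hf (fun _ => sq_nonneg _) hst hts
    have h4 : (∫ r in s..t, f r ^ 2) / l ≤ (∫ x, f x ^ 2) / l := by gcongr
    have h5 : |F t - F s| ≤ ∫ r in s..t, |f r| := by
      rw [h.sub_eq]
      exact intervalIntegral.abs_integral_le_integral_abs hst
    linarith
  have hN : 0 ≤ ∫ x, f x ^ 2 := integral_nonneg fun _ => sq_nonneg _
  rcases hst.eq_or_lt with rfl | hlt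
  · simp
  have hd : 0 < t - s := sub_pos.2 hlt
  rcases eq_or_ne (F t - F s) 0 with h0 | h0
  · rw [h0]
    simp only [ne_eq, OfNat.ofNat_ne_zero, not_false_eq_true, zero_pow]
    positivity
  · have hX : 0 < |F t - F s| := abs_pos.2 h0
    -- Cauchy-Schwarz by optimising Young's inequality: with `l` the absolute slope of the chord, `l
    -- (t - s) = |F t - F s|` is absorbed on the left.
    have h1 := hY (|F t - F s| / (t - s)) (by positivity)
    rw [div_mul_cancel₀ _ hd.ne'] at h1
    have h2 : |F t - F s| ≤ (∫ x, f x ^ 2) / (|F t - F s| / (t - s)) := by linarith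
    rw [le_div_iff₀ (by positivity), ← mul_div_assoc, div_le_iff₀ hd, ← sq, sq_abs] at h2
    linarith

end IsPrimitive

/-! ### Smooth test functions determine measures and densities -/

lemma integrable_of_continuous {f : AddCircle T → ℝ} (hf : Continuous f)
    (μ : Measure (AddCircle T)) [IsFiniteMeasure μ] : Integrable f μ :=
  hf.integrable_of_hasCompactSupport (HasCompactSupport.of_compactSpace _)

lemma integrable_continuous_mul {f φ : AddCircle T → ℝ} {μ : Measure (AddCircle T)}
    (hφ : Continuous φ) (hf : Integrable f μ) : Integrable (fun x => φ x * f x) μ := by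
  obtain ⟨C, hC⟩ := isCompact_univ.exists_bound_of_continuousOn hφ.continuousOn
  exact hf.bdd_mul hφ.aestronglyMeasurable (Eventually.of_forall fun x => hC x (mem_univ x))

lemma isCn_const {T : ℝ} (c : ℝ) (n : ℕ∞) : IsCn n (fun _ : AddCircle T => c) :=
  contDiff_const

/-- The algebra of smooth functions on the circle. -/
def smoothSubalgebra (T : ℝ) [Fact (0 < T)] :
    StarSubalgebra ℝ (BoundedContinuousFunction (AddCircle T) ℝ) where
  carrier := {g | IsCn (⊤ : ℕ∞) g}
  mul_mem' {f g} hf hg := ContDiff.mul (show IsCn (⊤ : ℕ∞) f from hf) hg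
  add_mem' {f g} hf hg := ContDiff.add (show IsCn (⊤ : ℕ∞) f from hf) hg
  algebraMap_mem' c := show IsCn (⊤ : ℕ∞) (fun _ : AddCircle T => c) from isCn_const c _
  star_mem' {f} hf := by
    have : star f = f := by
      ext x
      simp
    rwa [this]

lemma mem_smoothSubalgebra {g : BoundedContinuousFunction (AddCircle T) ℝ} :
    g ∈ smoothSubalgebra T ↔ IsCn (⊤ : ℕ∞) g := by
  change g ∈ {g : BoundedContinuousFunction (AddCircle T) ℝ | IsCn (⊤ : ℕ∞) g} ↔ _
  rw [mem_ofPred_eq]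

lemma exists_isCn_ne {x y : AddCircle T} (hxy : x ≠ y) :
    ∃ φ : AddCircle T → ℝ, IsCn (⊤ : ℕ∞) φ ∧ φ x ≠ φ y := by
  have hT : (0 : ℝ) < T := Fact.out
  have hc : IsCn (⊤ : ℕ∞) fun z : AddCircle T => ((AddCircle.toCircle z : Circle) : ℂ).re := by
    have : (fun t : ℝ => ((AddCircle.toCircle (t : AddCircle T) : Circle) : ℂ).re) =
        fun t => Real.cos (2 * Real.pi / T * t) := by
      funext t
      rw [AddCircle.toCircle_apply_mk, Circle.coe_exp, Complex.exp_ofReal_mul_I_re]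
    rw [IsCn, this]
    exact Real.contDiff_cos.comp (contDiff_const.mul contDiff_id)
  have hs : IsCn (⊤ : ℕ∞) fun z : AddCircle T => ((AddCircle.toCircle z : Circle) : ℂ).im := by
    have : (fun t : ℝ => ((AddCircle.toCircle (t : AddCircle T) : Circle) : ℂ).im) =
        fun t => Real.sin (2 * Real.pi / T * t) := by
      funext t
      rw [AddCircle.toCircle_apply_mk, Circle.coe_exp, Complex.exp_ofReal_mul_I_im]
    rw [IsCn, this]
    exact Real.contDiff_sin.comp (contDiff_const.mul contDiff_id)
  by_contra! h
  refine hxy (AddCircle.injective_toCircle hT.ne' (Circle.ext (Complex.ext ?_ ?_)))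
  · exact h _ hc
  · exact h _ hs

/-- The smooth functions form an algebra that separates points, by sine and cosine, and such an
algebra determines finite measures. -/
lemma measure_ext_of_isCn {μ ν : Measure (AddCircle T)} [IsFiniteMeasure μ] [IsFiniteMeasure ν]
    (h : ∀ φ : AddCircle T → ℝ, IsCn (⊤ : ℕ∞) φ → ∫ x, φ x ∂μ = ∫ x, φ x ∂ν) : μ = ν := by
  refine ext_of_forall_mem_subalgebra_integral_eq_of_pseudoEMetric_complete_countable (𝕜 := ℝ)
    (A := smoothSubalgebra T) ?_ fun g hg => h g (mem_smoothSubalgebra.1 hg)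
  intro x y hxy
  obtain ⟨φ, hφ, hne⟩ := exists_isCn_ne hxy
  refine ⟨φ, ⟨⟨φ, hφ.continuous⟩, ⟨BoundedContinuousFunction.mkOfCompact ⟨φ, hφ.continuous⟩,
    mem_smoothSubalgebra.2 hφ, rfl⟩, rfl⟩, hne⟩

/-- Splits the signed measure `k μ` into its positive and negative parts, so that
`measure_ext_of_isCn`, a statement on positive measures, applies to signed densities. -/
lemma integral_withDensity_ofReal_sub {k : AddCircle T → ℝ} {μ : Measure (AddCircle T)}
    (hk : Integrable k μ) {φ : AddCircle T → ℝ} (hφ : Continuous φ) :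
    ∫ x, φ x ∂(μ.withDensity fun x => ENNReal.ofReal (k x)) -
      ∫ x, φ x ∂(μ.withDensity fun x => ENNReal.ofReal (-k x)) = ∫ x, k x * φ x ∂μ := by
  rw [integral_withDensity_eq_integral_toReal_smul₀ hk.aemeasurable.ennreal_ofReal
      (Eventually.of_forall fun _ => ENNReal.ofReal_lt_top),
    integral_withDensity_eq_integral_toReal_smul₀ (f := fun x => ENNReal.ofReal (-k x))
      hk.neg.aemeasurable.ennreal_ofReal
      (Eventually.of_forall fun _ => ENNReal.ofReal_lt_top), ← integral_sub]
  · refine integral_congr_ae (Eventually.of_forall fun x => ?_)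
    simp only [ENNReal.toReal_ofReal', smul_eq_mul]
    rcases le_total 0 (k x) with h | h
    · rw [max_eq_left h, max_eq_right (by linarith)]
      ring
    · rw [max_eq_right h, max_eq_left (by linarith)]
      ring
  · simp only [ENNReal.toReal_ofReal', smul_eq_mul]
    simpa only [mul_comm] using integrable_continuous_mul hφ hk.pos_part
  · simp only [ENNReal.toReal_ofReal', smul_eq_mul]
    simpa only [mul_comm, Pi.neg_apply] using integrable_continuous_mul hφ hk.neg.pos_part

lemma isFiniteMeasure_withDensity_integrable {T : ℝ} {k : AddCircle T → ℝ} {μ : Measure (AddCircle T)}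
    (hk : Integrable k μ) : IsFiniteMeasure (μ.withDensity fun x => ENNReal.ofReal (k x)) :=
  isFiniteMeasure_withDensity_ofReal hk.2

lemma ae_eq_zero_of_integral_mul_isCn {k : AddCircle T → ℝ} (hk : Integrable k volume)
    (h : ∀ φ : AddCircle T → ℝ, IsCn (⊤ : ℕ∞) φ → ∫ x, k x * φ x = 0) :
    k =ᵐ[volume] 0 := by
  have := isFiniteMeasure_withDensity_integrable hk
  have := isFiniteMeasure_withDensity_integrable hk.neg
  have he : (volume.withDensity fun x => ENNReal.ofReal (k x)) =
      volume.withDensity fun x => ENNReal.ofReal ((-k) x) :=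
    measure_ext_of_isCn fun φ hφ => by
      rw [← sub_eq_zero]
      exact (integral_withDensity_ofReal_sub hk hφ.continuous).trans (h φ hφ)
  rw [withDensity_eq_iff hk.aemeasurable.ennreal_ofReal hk.neg.aemeasurable.ennreal_ofReal
    hk.lintegral_lt_top.ne] at he
  filter_upwards [he] with x hx
  simp only [Pi.neg_apply] at hx
  rcases lt_trichotomy (k x) 0 with h0 | h0 | h0
  · rw [ENNReal.ofReal_of_nonpos h0.le] at hx
    have := ENNReal.ofReal_eq_zero.1 hx.symm
    linarith
  · exact h0
  · rw [ENNReal.ofReal_of_nonpos (p := -k x) (by linarith)] at hx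
    have := ENNReal.ofReal_eq_zero.1 hx
    linarith

/-- The sign of `R` is not known in advance. The hypothesis therefore reads `a μ + R⁻ dx = R⁺ dx`,
an equality of positive measures, so `a μ ≤ R⁺ dx`, and `a > 0` passes this on to `μ`. -/
lemma absolutelyContinuous_of_integral_mul_isCn {μ : Measure (AddCircle T)} [IsFiniteMeasure μ]
    {a R : AddCircle T → ℝ} (ha : Continuous a) (ha0 : ∀ x, 0 < a x) (hR : Integrable R volume)
    (h : ∀ φ : AddCircle T → ℝ, IsCn (⊤ : ℕ∞) φ → ∫ x, a x * φ x ∂μ = ∫ x, R x * φ x) :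
    μ ≪ volume := by
  have haI := integrable_of_continuous ha μ
  have := isFiniteMeasure_withDensity_integrable haI
  have := isFiniteMeasure_withDensity_integrable hR
  have := isFiniteMeasure_withDensity_integrable hR.neg
  have he : (μ.withDensity fun x => ENNReal.ofReal (a x)) +
      (volume.withDensity fun x => ENNReal.ofReal ((-R) x)) =
      volume.withDensity fun x => ENNReal.ofReal (R x) := by
    refine measure_ext_of_isCn fun φ hφ => ?_
    rw [integral_add_measure (integrable_of_continuous hφ.continuous _)
      (integrable_of_continuous hφ.continuous _)]
    have h1 := integral_withDensity_ofReal_sub haI hφ.continuous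
    have h2 := integral_withDensity_ofReal_sub hR hφ.continuous
    have h3 : (μ.withDensity fun x => ENNReal.ofReal (-a x)) = 0 := by
      have : (fun x => ENNReal.ofReal (-a x)) = 0 := by
        funext x
        exact ENNReal.ofReal_of_nonpos (by linarith [ha0 x])
      rw [this, withDensity_zero]
    rw [h3, integral_zero_measure, sub_zero, h φ hφ, ← h2] at h1
    simp only [Pi.neg_apply]
    linarith
  have h1 : μ ≪ μ.withDensity fun x => ENNReal.ofReal (a x) :=
    withDensity_absolutelyContinuous' haI.aemeasurable.ennreal_ofReal
      (Eventually.of_forall fun x => by simpa using ha0 x)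
  refine h1.trans (Measure.AbsolutelyContinuous.trans ?_
    (withDensity_absolutelyContinuous volume fun x => ENNReal.ofReal (R x)))
  rw [← he]
  exact Measure.absolutelyContinuous_of_le (Measure.le_add_right le_rfl)

/-! ### Existence of primitives -/

lemma exists_isPrimitive {f : AddCircle T → ℝ} (hf : Integrable f volume) (h0 : ∫ x, f x = 0) :
    ∃ F : AddCircle T → ℝ, IsPrimitive F f ∧ ∀ t : ℝ, F t = ∫ s in (0 : ℝ)..t, f s := by
  have hI := intervalIntegrable_lift hf
  have hper : Function.Periodic (fun t : ℝ => ∫ s in (0 : ℝ)..t, f s) T := fun t => by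
    change ∫ s in (0 : ℝ)..t + T, f s = ∫ s in (0 : ℝ)..t, f s
    rw [← intervalIntegral.integral_add_adjacent_intervals (hI 0 t) (hI t (t + T)),
      AddCircle.intervalIntegral_preimage T t f, h0, add_zero]
  have hF : ∀ t : ℝ, hper.lift (t : AddCircle T) = ∫ s in (0 : ℝ)..t, f s := fun t => rfl
  refine ⟨hper.lift, ⟨hf, fun x y => ?_⟩, hF⟩
  rw [hF, hF, intervalIntegral.integral_interval_sub_left (hI _ _) (hI _ _)]

lemma IsPrimitive.hasDerivAt {F f : AddCircle T → ℝ} (h : IsPrimitive F f) (hf : Continuous f)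
    (t : ℝ) : HasDerivAt (fun t : ℝ => F t) (f t) t := by
  rw [h.lift_eq]
  exact ((hf.comp (AddCircle.continuous_mk' T)).integral_hasStrictDerivAt 0 t).hasDerivAt.const_add _

lemma IsPrimitive.circleDeriv_eq {F f : AddCircle T → ℝ} (h : IsPrimitive F f)
    (hf : Continuous f) : circleDeriv F = f := by
  funext x
  obtain ⟨s, rfl⟩ := QuotientAddGroup.mk_surjective x
  exact (circleDeriv_coe F s).trans (h.hasDerivAt hf s).deriv

lemma IsPrimitive.isCn {F f : AddCircle T → ℝ} (h : IsPrimitive F f) (hf : IsCn (⊤ : ℕ∞) f) :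
    IsCn (⊤ : ℕ∞) F := by
  have hd := h.hasDerivAt hf.continuous
  have := contDiff_infty_iff_deriv (𝕜 := ℝ) (f := fun t : ℝ => F t)
  refine this.2 ⟨fun t => (hd t).differentiableAt, ?_⟩
  have e : deriv (fun t : ℝ => F t) = fun t : ℝ => f t := by
    funext t
    exact (hd t).deriv
  rw [e]
  exact hf

lemma isCn_sub_const {T : ℝ} {φ : AddCircle T → ℝ} {n : ℕ∞} (hφ : IsCn n φ) (c : ℝ) :
    IsCn n (fun x => φ x - c) :=
  ContDiff.sub hφ contDiff_const

/-- The mean value of a function on the circle. -/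
def mean (f : AddCircle T → ℝ) : ℝ := T⁻¹ * ∫ x, f x

lemma measureReal_univ : (volume : Measure (AddCircle T)).real univ = T := by
  have hT : (0 : ℝ) < T := Fact.out
  rw [measureReal_def, AddCircle.measure_univ, ENNReal.toReal_ofReal hT.le]

lemma integral_sub_mean {f : AddCircle T → ℝ} (hf : Integrable f volume) :
    ∫ x, (f x - mean f) = 0 := by
  have hT : (0 : ℝ) < T := Fact.out
  rw [integral_sub hf (integrable_const _), integral_const, measureReal_univ, mean, smul_eq_mul]
  field_simp
  ring

/-- The du Bois-Reymond lemma: any smooth `φ` minus its mean is the derivative of a smooth function,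
so `k - mean k` is orthogonal to every `φ`. -/
lemma ae_eq_const_of_integral_mul_circleDeriv {k : AddCircle T → ℝ} (hk : Integrable k volume)
    (h : ∀ φ : AddCircle T → ℝ, IsCn (⊤ : ℕ∞) φ → ∫ x, k x * circleDeriv φ x = 0) :
    ∃ c : ℝ, ∀ᵐ x, k x = c := by
  refine ⟨mean k, ?_⟩
  have h0 := ae_eq_zero_of_integral_mul_isCn (k := fun x => k x - mean k)
    (hk.sub (integrable_const _)) fun φ hφ => by
      have hφI := integrable_of_continuous hφ.continuous volume
      obtain ⟨F, hF, -⟩ := exists_isPrimitive (hφI.sub (integrable_const (mean φ)))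
        (integral_sub_mean hφI)
      have h1 := h F (hF.isCn (isCn_sub_const hφ _))
      rw [hF.circleDeriv_eq (hφ.continuous.sub continuous_const)] at h1
      have h2 : ∫ x, k x * (φ x - mean φ) = (∫ x, k x * φ x) - mean φ * ∫ x, k x := by
        rw [← integral_const_mul, ← integral_sub (integrable_mul_of_continuous hk hφ.continuous)
          (hk.const_mul _)]
        congr 1
        funext x
        ring
      have h3 : ∫ x, (k x - mean k) * φ x = (∫ x, k x * φ x) - mean k * ∫ x, φ x := by
        rw [← integral_const_mul, ← integral_sub (integrable_mul_of_continuous hk hφ.continuous)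
          (hφI.const_mul _)]
        congr 1
        funext x
        ring
      change ∫ x, k x * (φ x - mean φ) = 0 at h1
      rw [h3, ← h1, h2, mean, mean]
      ring
  filter_upwards [h0] with x hx
  exact sub_eq_zero.1 hx

/-- The constant test function shows that `g` has mean zero, hence a periodic primitive; it differs
from `f` by a function of zero weak derivative, that is, by a constant. -/
lemma HasWeakDeriv.exists_isPrimitive {f g : AddCircle T → ℝ} (h : HasWeakDeriv f g) :
    ∃ F, IsPrimitive F g ∧ f =ᵐ[volume] F := by
  have h0 : ∫ x, g x = 0 := by
    have := h.integral_eq _ (isCn_const 1 _)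
    have e : circleDeriv (fun _ : AddCircle T => (1 : ℝ)) = 0 := by
      funext x
      simp [circleDeriv]
    rw [e] at this
    simpa using this
  obtain ⟨G, hG, -⟩ := Circle1D.exists_isPrimitive h.integrable_right h0
  have hGI := integrable_of_continuous hG.continuous volume
  obtain ⟨c, hc⟩ := ae_eq_const_of_integral_mul_circleDeriv (h.integrable_left.sub hGI)
    fun φ hφ => by
      simp only [Pi.sub_apply, sub_mul]
      have hd := hφ.continuous_circleDeriv le_top
      rw [integral_sub (integrable_mul_of_continuous h.integrable_left hd)
        (integrable_mul_of_continuous hGI hd), h.integral_eq φ hφ, hG.hasWeakDeriv.integral_eq φ hφ,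
        sub_self]
  refine ⟨fun x => G x + c, by simpa using hG.add (.const c), ?_⟩
  filter_upwards [hc] with x hx
  simp only [Pi.sub_apply] at hx
  linarith

lemma eq_of_ae_eq_of_continuous {F G : AddCircle T → ℝ} (hF : Continuous F) (hG : Continuous G)
    (h : F =ᵐ[volume] G) : F = G :=
  (hF.ae_eq_iff_eq volume hG).1 h

lemma HasWeakDeriv.isPrimitive {f g : AddCircle T → ℝ} (h : HasWeakDeriv f g)
    (hf : Continuous f) : IsPrimitive f g := by
  obtain ⟨F, hF, hfF⟩ := h.exists_isPrimitive
  rwa [eq_of_ae_eq_of_continuous hf hF.continuous hfF]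

lemma HasWeakDeriv.ae_unique {f g g' : AddCircle T → ℝ} (h : HasWeakDeriv f g)
    (h' : HasWeakDeriv f g') : g =ᵐ[volume] g' := by
  have := ae_eq_zero_of_integral_mul_isCn (h.integrable_right.sub h'.integrable_right)
    fun φ hφ => by
      simp only [Pi.sub_apply, sub_mul]
      rw [integral_sub (integrable_mul_of_continuous h.integrable_right hφ.continuous)
        (integrable_mul_of_continuous h'.integrable_right hφ.continuous)]
      have h1 := h.integral_eq φ hφ
      have h2 := h'.integral_eq φ hφ
      linarith
  filter_upwards [this] with x hx
  exact sub_eq_zero.1 hx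

/-! ### Regularity of measures annihilating a second order operator -/

/-- The coordinate in `(0, T]` of a point of the circle. -/
def coord (x : AddCircle T) : ℝ := AddCircle.equivIoc T 0 x

lemma measurable_coord : Measurable (coord : AddCircle T → ℝ) :=
  measurable_subtype_coe.comp (AddCircle.measurableEquivIoc T 0).measurable

lemma coe_coord (x : AddCircle T) : (coord x : AddCircle T) = x := AddCircle.coe_equivIoc

lemma coord_mem (x : AddCircle T) : coord x ∈ Ioc 0 T := by
  have h := (AddCircle.equivIoc T 0 x).2
  exact ⟨h.1, h.2.trans (zero_add T).le⟩

lemma coord_coe {t : ℝ} (ht : t ∈ Ioc 0 T) : coord (t : AddCircle T) = t := by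
  unfold coord
  rw [AddCircle.equivIoc_coe_of_mem]
  simpa using ht

lemma integral_indicator_coord_le (k : AddCircle T → ℝ) (x : AddCircle T) :
    ∫ y, {y | coord y ≤ coord x}.indicator k y = ∫ t in (0 : ℝ)..coord x, k t := by
  obtain ⟨h0, hT⟩ := coord_mem x
  rw [← AddCircle.integral_preimage T 0, intervalIntegral.integral_of_le h0.le, zero_add]
  have : ∀ t ∈ Ioc 0 T, {y | coord y ≤ coord x}.indicator k (t : AddCircle T) =
      (Ioc 0 (coord x)).indicator (fun t : ℝ => k t) t := by
    intro t ht
    by_cases h : t ≤ coord x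
    · rw [indicator_of_mem (show (t : AddCircle T) ∈ {y | coord y ≤ coord x} by
        simpa [coord_coe ht] using h), indicator_of_mem (show t ∈ Ioc 0 (coord x) from ⟨ht.1, h⟩)]
    · rw [indicator_of_notMem (show (t : AddCircle T) ∉ {y | coord y ≤ coord x} by
        simpa [coord_coe ht] using h), indicator_of_notMem fun h' => h h'.2]
  rw [setIntegral_congr_fun measurableSet_Ioc this, setIntegral_indicator measurableSet_Ioc]
  congr 2
  exact inter_eq_right.2 (Ioc_subset_Ioc_right hT)

/-- Integrating a primitive against a finite signed measure `b μ` amounts to integrating its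
derivative against a fixed integrable function. -/
lemma exists_integral_mul_primitive {μ : Measure (AddCircle T)} [IsFiniteMeasure μ]
    {b : AddCircle T → ℝ} (hb : Integrable b μ) :
    ∃ Φ : AddCircle T → ℝ, Integrable Φ volume ∧ ∀ k G : AddCircle T → ℝ, Continuous k →
      (∀ t : ℝ, G t = ∫ s in (0 : ℝ)..t, k s) → ∫ x, b x * G x ∂μ = ∫ x, Φ x * k x := by
  -- Writing `G x` as the integral of `k` over points of smaller coordinate and applying Fubini
  -- gives `Φ y = ∫ b` over the points of coordinate at least that of `y`. This is insensitive to
  -- atoms of `μ`.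
  let S : Set (AddCircle T × AddCircle T) := {p | coord p.2 ≤ coord p.1}
  have hS : MeasurableSet S :=
    measurableSet_le (measurable_coord.comp measurable_snd) (measurable_coord.comp measurable_fst)
  have hint : ∀ k : AddCircle T → ℝ, Continuous k →
      Integrable (S.indicator fun p => b p.1 * k p.2) (μ.prod volume) := fun k hk =>
    (hb.mul_prod (integrable_of_continuous hk volume)).indicator hS
  have hconst := hint (fun _ => 1) continuous_const
  refine ⟨fun y => ∫ x, S.indicator (fun p => b p.1 * 1) (x, y) ∂μ, hconst.integral_prod_right,
    fun k G hk hG => ?_⟩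
  have h1 : ∀ x, b x * G x = ∫ y, S.indicator (fun p => b p.1 * k p.2) (x, y) := by
    intro x
    have : G x = ∫ t in (0 : ℝ)..coord x, k t := by rw [← hG, coe_coord]
    rw [this, ← integral_indicator_coord_le, ← integral_const_mul]
    refine integral_congr_ae (Eventually.of_forall fun y => ?_)
    by_cases h : coord y ≤ coord x
    · simp [S, indicator, h]
    · simp [S, indicator, h]
  simp only [h1]
  rw [integral_integral_swap (f := fun x y => S.indicator (fun p => b p.1 * k p.2) (x, y))
    (hint k hk)]
  refine integral_congr_ae (Eventually.of_forall fun y => ?_)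
  simp only
  rw [← integral_mul_const]
  refine integral_congr_ae (Eventually.of_forall fun x => ?_)
  by_cases h : coord y ≤ coord x
  · simp [S, indicator, h]
  · simp [S, indicator, h]

/-- Testing with the mean-free primitive of `φ - mean φ` makes `φ - mean φ` the factor of `a`, while
Fubini rewrites the term with `b` as an integral of `φ - mean φ` against an `L¹` function. So `a μ`
is itself given by an `L¹` density. -/
lemma absolutelyContinuous_of_stationary {μ : Measure (AddCircle T)} [IsFiniteMeasure μ]
    {a b : AddCircle T → ℝ} (ha : Continuous a) (ha0 : ∀ x, 0 < a x) (hb : Integrable b μ)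
    (h : ∀ φ : AddCircle T → ℝ, IsCn (⊤ : ℕ∞) φ → ∫ x, φ x = 0 →
      ∫ x, a x * circleDeriv φ x + b x * φ x ∂μ = 0) : μ ≪ volume := by
  obtain ⟨Φ, hΦ, hΦG⟩ := exists_integral_mul_primitive hb
  obtain ⟨Φ₁, hΦ₁, hΦG₁⟩ := exists_integral_mul_primitive (μ := volume)
    (b := fun _ : AddCircle T => (1 : ℝ)) (integrable_const _)
  have haI := integrable_of_continuous ha μ
  set Ψ : AddCircle T → ℝ := fun x => (T⁻¹ * ∫ x, b x ∂μ) * Φ₁ x - Φ x with hΨd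
  have hΨ : Integrable Ψ volume := (hΦ₁.const_mul _).sub hΦ
  -- `Φ` represents `b μ` and `Φ₁` the subtraction of `mean G`; the added constant collects the
  -- terms in `mean φ`.
  refine absolutelyContinuous_of_integral_mul_isCn (R := fun x => Ψ x +
    T⁻¹ * (∫ x, a x ∂μ - ∫ x, Ψ x)) ha ha0 (hΨ.add (integrable_const _)) fun φ hφ => ?_
  have hφc := hφ.continuous
  have hφI := integrable_of_continuous hφc volume
  have hk : Continuous fun x => φ x - mean φ := hφc.sub continuous_const
  obtain ⟨G, hG, hG0⟩ := exists_isPrimitive (integrable_of_continuous hk volume)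
    (integral_sub_mean hφI)
  have hGI := integrable_of_continuous hG.continuous volume
  have hGs := hG.isCn (isCn_sub_const hφ _)
  have hG' : IsPrimitive (fun x => G x - mean G) (fun x => φ x - mean φ) := by
    simpa using hG.sub (.const (mean G))
  have h1 := h _ (isCn_sub_const hGs (mean G)) (integral_sub_mean hGI)
  rw [hG'.circleDeriv_eq hk, integral_add
    (by simpa only [mul_comm] using integrable_continuous_mul hk haI)
    (by simpa only [mul_comm] using integrable_continuous_mul hG'.continuous hb)] at h1
  have h2 : ∫ x, a x * (φ x - mean φ) ∂μ = (∫ x, a x * φ x ∂μ) - mean φ * ∫ x, a x ∂μ := by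
    rw [← integral_const_mul, ← integral_sub
      (by simpa only [mul_comm] using integrable_continuous_mul hφc haI) (haI.const_mul _)]
    congr 1
    funext x
    ring
  have h3 : ∫ x, b x * (G x - mean G) ∂μ = (∫ x, b x * G x ∂μ) - mean G * ∫ x, b x ∂μ := by
    rw [← integral_const_mul, ← integral_sub
      (by simpa only [mul_comm] using integrable_continuous_mul hG.continuous hb)
      (hb.const_mul _)]
    congr 1
    funext x
    ring
  have h4 := hΦG _ G hk hG0
  have h5 := hΦG₁ _ G hk hG0
  simp only [one_mul] at h5
  have h6 : ∫ x, (Ψ x + T⁻¹ * (∫ x, a x ∂μ - ∫ x, Ψ x)) * φ x =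
      (T⁻¹ * ∫ x, b x ∂μ) * (∫ x, Φ₁ x * (φ x - mean φ)) - (∫ x, Φ x * (φ x - mean φ))
        + mean φ * ∫ x, a x ∂μ := by
    have e1 : ∫ x, (Ψ x + T⁻¹ * (∫ x, a x ∂μ - ∫ x, Ψ x)) * φ x =
        (∫ x, Ψ x * φ x) + (T⁻¹ * (∫ x, a x ∂μ - ∫ x, Ψ x)) * ∫ x, φ x := by
      rw [← integral_const_mul, ← integral_add (integrable_mul_of_continuous hΨ hφc)
        (hφI.const_mul _)]
      congr 1
      funext x
      ring
    have e2 : (T⁻¹ * ∫ x, b x ∂μ) * (∫ x, Φ₁ x * (φ x - mean φ)) - (∫ x, Φ x * (φ x - mean φ)) =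
        ∫ x, Ψ x * (φ x - mean φ) := by
      rw [← integral_const_mul, ← integral_sub
        ((integrable_mul_of_continuous hΦ₁ hk).const_mul _) (integrable_mul_of_continuous hΦ hk)]
      congr 1
      funext x
      rw [hΨd]
      ring
    have e3 : ∫ x, Ψ x * (φ x - mean φ) = (∫ x, Ψ x * φ x) - mean φ * ∫ x, Ψ x := by
      rw [← integral_const_mul, ← integral_sub (integrable_mul_of_continuous hΨ hφc)
        (hΨ.const_mul _)]
      congr 1
      funext x
      ring
    rw [e1, e2, e3, mean]
    ring
  rw [h6, ← h4, ← h5]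
  rw [h2, h3] at h1
  have hm : mean G * ∫ x, b x ∂μ = (T⁻¹ * ∫ x, b x ∂μ) * ∫ x, G x := by
    rw [mean]
    ring
  linarith

/-- A finite measure `μ` annihilating `a f'' + b f'` for all smooth `f` has density `P / a`, where
`P` is absolutely continuous with `P' = b P / a - κ`. -/
lemma exists_density_of_stationary {μ : Measure (AddCircle T)} [IsFiniteMeasure μ]
    {a b : AddCircle T → ℝ} (ha : Continuous a) (ha0 : ∀ x, 0 < a x) (hb : Integrable b μ)
    (h : ∀ φ : AddCircle T → ℝ, IsCn (⊤ : ℕ∞) φ → ∫ x, φ x = 0 →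
      ∫ x, a x * circleDeriv φ x + b x * φ x ∂μ = 0) :
    ∃ (P : AddCircle T → ℝ) (κ : ℝ), IsPrimitive P (fun x => b x * (P x / a x) - κ) ∧
      (∀ x, 0 ≤ P x) ∧ μ = volume.withDensity fun x => ENNReal.ofReal (P x / a x) := by
  have hac := absolutelyContinuous_of_stationary ha ha0 hb h
  set ρ : AddCircle T → ℝ := fun x => (μ.rnDeriv volume x).toReal with hρ
  have hI : ∀ f : AddCircle T → ℝ, Integrable f μ → Integrable (fun x => ρ x * f x) volume :=
    fun f hf => (integrable_rnDeriv_smul_iff hac).2 hf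
  have hE : ∀ f : AddCircle T → ℝ, ∫ x, ρ x * f x = ∫ x, f x ∂μ :=
    fun f => integral_rnDeriv_smul hac
  have haρ := hI a (integrable_of_continuous ha μ)
  have hbρ := hI b hb
  -- Only test functions of mean zero are available, so the derivative is determined up to a
  -- constant, which is fixed because a derivative on the circle has mean zero. This constant
  -- becomes `κ`.
  have hw : HasWeakDeriv (fun x => ρ x * a x) (fun x => ρ x * b x - mean fun x => ρ x * b x) := by
    refine ⟨haρ, hbρ.sub (integrable_const _), fun φ hφ => ?_⟩
    have hφc := hφ.continuous
    have hd := hφ.continuous_circleDeriv le_top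
    have hφI := integrable_of_continuous hφc volume
    have h1 := h _ (isCn_sub_const hφ (mean φ)) (integral_sub_mean hφI)
    have hp : IsPrimitive (fun x => φ x - mean φ) (circleDeriv φ) := by
      simpa using (IsPrimitive.of_isCn hφ le_top).sub (.const (mean φ))
    rw [hp.circleDeriv_eq hd, ← hE] at h1
    have e1 : ∀ x, ρ x * (a x * circleDeriv φ x + b x * (φ x - mean φ)) =
        ρ x * a x * circleDeriv φ x + (ρ x * b x * φ x - mean φ * (ρ x * b x)) := fun x => by ring
    simp only [e1] at h1
    have i1 := integrable_mul_of_continuous hbρ hφc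
    have i2 : Integrable (fun x => ρ x * b x * φ x - mean φ * (ρ x * b x)) volume :=
      i1.sub (hbρ.const_mul _)
    rw [integral_add (integrable_mul_of_continuous haρ hd) i2,
      integral_sub i1 (hbρ.const_mul _), integral_const_mul] at h1
    have e2 : ∫ x, (ρ x * b x - mean fun x => ρ x * b x) * φ x =
        (∫ x, ρ x * b x * φ x) - (mean fun x => ρ x * b x) * ∫ x, φ x := by
      simp only [sub_mul]
      rw [integral_sub i1 (hφI.const_mul _), integral_const_mul]
    rw [e2]
    have e3 : (mean fun x => ρ x * b x) * ∫ x, φ x = mean φ * ∫ x, ρ x * b x := by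
      rw [mean, mean]
      ring
    linarith
  obtain ⟨P, hP, hPe⟩ := hw.exists_isPrimitive
  have hρP : ∀ᵐ x, ρ x = P x / a x := by
    filter_upwards [hPe] with x hx
    rw [← hx, mul_div_cancel_right₀ _ (ha0 x).ne']
  refine ⟨P, mean fun x => ρ x * b x, hP.congr_ae ?_, ?_, ?_⟩
  · filter_upwards [hρP] with x hx
    rw [hx]
    ring
  -- Non-negativity is known almost everywhere; the continuous functions `max P 0` and `P` then
  -- agree everywhere.
  · have h1 : (fun x => max (P x) 0) =ᵐ[volume] P := by
      filter_upwards [hPe] with x hx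
      rw [← hx]
      exact max_eq_left (mul_nonneg ENNReal.toReal_nonneg (ha0 x).le)
    have h2 := eq_of_ae_eq_of_continuous (hP.continuous.max continuous_const) hP.continuous h1
    intro x
    rw [← h2]
    exact le_max_right _ _
  · rw [← Measure.withDensity_rnDeriv_eq μ volume hac]
    refine withDensity_congr_ae ?_
    filter_upwards [hρP, Measure.rnDeriv_lt_top μ volume] with x hx hlt
    rw [← hx, hρ, ENNReal.ofReal_toReal hlt.ne]

/-! ### A priori estimates for the density -/

/-- `u ≥ 0` is a probability density solving the once integrated stationary Fokker-Planck equation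
`ε² (a u' + β u) = B u - κ`, whose coefficients obey quantitative bounds. -/
structure DensityEquation (B dB : AddCircle T → ℝ) (b₀ b₁ K a₀ a₁ N : ℝ)
    (a β : AddCircle T → ℝ) (ε κ : ℝ) (u du : AddCircle T → ℝ) : Prop where
  isPrimitive_B : IsPrimitive B dB
  b₀_pos : 0 < b₀
  le_B : ∀ x, b₀ ≤ B x
  B_le : ∀ x, B x ≤ b₁
  measurable_dB : Measurable dB
  abs_dB_le : ∀ x, |dB x| ≤ K
  continuous_a : Continuous a
  a₀_pos : 0 < a₀
  le_a : ∀ x, a₀ ≤ a x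
  a_le : ∀ x, a x ≤ a₁
  memLp_β : MemLp β 2 volume
  integral_β_sq_le : ∫ x, β x ^ 2 ≤ N
  ε_pos : 0 < ε
  isPrimitive_u : IsPrimitive u du
  u_nonneg : ∀ x, 0 ≤ u x
  integral_u : ∫ x, u x = 1
  eq : ∀ x, ε ^ 2 * (a x * du x + β x * u x) = B x * u x - κ

namespace DensityEquation

variable {B dB : AddCircle T → ℝ} {b₀ b₁ K a₀ a₁ N : ℝ} {a β : AddCircle T → ℝ} {ε κ : ℝ}
  {u du : AddCircle T → ℝ}

lemma du_eq (h : DensityEquation B dB b₀ b₁ K a₀ a₁ N a β ε κ u du) (x : AddCircle T) :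
    du x = (a x)⁻¹ * ((ε ^ 2)⁻¹ * (B x * u x - κ)) - ((a x)⁻¹ * u x) * β x := by
  have ha : a x ≠ 0 := (h.a₀_pos.trans_le (h.le_a x)).ne'
  have hε := h.ε_pos.ne'
  rw [← h.eq x]
  field_simp
  ring

lemma memLp_continuous_mul {φ f : AddCircle T → ℝ} (hφ : Continuous φ) (hf : MemLp f 2 volume) :
    MemLp (fun x => φ x * f x) 2 volume := by
  obtain ⟨C, hC⟩ := isCompact_univ.exists_bound_of_continuousOn hφ.continuousOn
  refine hf.of_le_mul (c := C) (hφ.aestronglyMeasurable.mul hf.1)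
    (Eventually.of_forall fun x => ?_)
  rw [norm_mul]
  exact mul_le_mul_of_nonneg_right (hC x (mem_univ x)) (norm_nonneg _)

lemma memLp_of_continuous {φ : AddCircle T → ℝ} (hφ : Continuous φ) (p : ℝ≥0∞) :
    MemLp φ p volume := by
  obtain ⟨C, hC⟩ := isCompact_univ.exists_bound_of_continuousOn hφ.continuousOn
  exact MemLp.of_bound hφ.aestronglyMeasurable C (Eventually.of_forall fun x => hC x (mem_univ x))

/-- Qualitative only: it makes the integrals below meaningful, while solving the equation for `u'`
gives no bound uniform in `ε`. -/
lemma memLp_du (h : DensityEquation B dB b₀ b₁ K a₀ a₁ N a β ε κ u du) : MemLp du 2 volume := by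
  have e : du = fun x => (a x)⁻¹ * ((ε ^ 2)⁻¹ * (B x * u x - κ)) - ((a x)⁻¹ * u x) * β x :=
    funext h.du_eq
  have hu := h.isPrimitive_u.continuous
  have ha : Continuous fun x => (a x)⁻¹ :=
    h.continuous_a.inv₀ fun x => (h.a₀_pos.trans_le (h.le_a x)).ne'
  have hB := h.isPrimitive_B.continuous
  have h1 := memLp_of_continuous
    (ha.mul (continuous_const.mul ((hB.mul hu).sub continuous_const)) :
      Continuous fun x => (a x)⁻¹ * ((ε ^ 2)⁻¹ * (B x * u x - κ))) 2
  rw [e]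
  exact h1.sub (memLp_continuous_mul (ha.mul hu) h.memLp_β)

lemma isPrimitive_flux (h : DensityEquation B dB b₀ b₁ K a₀ a₁ N a β ε κ u du) :
    IsPrimitive (fun x => B x * u x - κ) (fun x => dB x * u x + B x * du x) := by
  simpa using (h.isPrimitive_B.mul h.isPrimitive_u).sub (.const κ)

lemma N_nonneg (h : DensityEquation B dB b₀ b₁ K a₀ a₁ N a β ε κ u du) : 0 ≤ N :=
  (integral_nonneg fun _ => sq_nonneg _).trans h.integral_β_sq_le

lemma memLp_flux_deriv (h : DensityEquation B dB b₀ b₁ K a₀ a₁ N a β ε κ u du) :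
    MemLp (fun x => dB x * u x + B x * du x) 2 volume := by
  have h1 : MemLp dB 2 volume := MemLp.of_bound h.measurable_dB.aestronglyMeasurable K
    (Eventually.of_forall h.abs_dB_le)
  have h2 : MemLp (fun x => dB x * u x) 2 volume := by
    simpa only [mul_comm] using memLp_continuous_mul h.isPrimitive_u.continuous h1
  exact h2.add (memLp_continuous_mul h.isPrimitive_B.continuous h.memLp_du)

/-- The constant of the energy estimate. -/
def energyConst (T b₀ b₁ K a₀ a₁ N : ℝ) : ℝ :=
  2 / (a₀ * b₀) * ((a₁ ^ 2 * K ^ 2 / (a₀ * b₀) + K ^ 2 / 2) * T +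
    (b₁ ^ 2 / (a₀ * b₀) + 1 / 2) * N)

lemma energyConst_nonneg (h : DensityEquation B dB b₀ b₁ K a₀ a₁ N a β ε κ u du) :
    0 ≤ energyConst T b₀ b₁ K a₀ a₁ N := by
  have hT : (0 : ℝ) < T := Fact.out
  have h1 := h.a₀_pos
  have h2 := h.b₀_pos
  have h3 := h.N_nonneg
  unfold energyConst
  positivity

/-- Multiplying the equation by `ε⁻² (B u)'` and integrating kills the right side, which is a
multiple of the derivative of `(B u - κ)²`. What remains is `∫ (a u' + β u)(B u)' = 0`, whose
leading term is `∫ a B u'²`; all other terms contain a factor `u` and are controlled by `M`. -/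
lemma integral_du_sq_le (h : DensityEquation B dB b₀ b₁ K a₀ a₁ N a β ε κ u du) {M : ℝ}
    (hM : ∀ x, u x ≤ M) :
    ∫ x, du x ^ 2 ≤ energyConst T b₀ b₁ K a₀ a₁ N * M ^ 2 := by
  have ha₀ := h.a₀_pos
  have hb₀ := h.b₀_pos
  have hε := h.ε_pos
  set c := a₀ * b₀ with hc
  have hc0 : 0 < c := by positivity
  have hw := h.isPrimitive_flux
  have hww := hw.mul hw
  have hE0 : ∫ x, (ε ^ 2)⁻¹ * ((B x * u x - κ) * (dB x * u x + B x * du x)) = 0 := by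
    have h1 := hww.integral_eq_zero
    have e : ∀ x, (dB x * u x + B x * du x) * (B x * u x - κ) +
        (B x * u x - κ) * (dB x * u x + B x * du x) =
        2 * ((B x * u x - κ) * (dB x * u x + B x * du x)) := fun x => by ring
    simp only [e] at h1
    rw [integral_const_mul] at h1 ⊢
    have : ∫ x, (B x * u x - κ) * (dB x * u x + B x * du x) = 0 := by linarith
    rw [this, mul_zero]
  have hEI : Integrable
      (fun x => (ε ^ 2)⁻¹ * ((B x * u x - κ) * (dB x * u x + B x * du x))) volume :=
    (integrable_continuous_mul hw.continuous hw.integrable).const_mul _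
  have hβI := h.memLp_β.integrable_sq
  have hGI : Integrable (fun x => ((a₁ ^ 2 * K ^ 2 / c + K ^ 2 / 2) +
      (b₁ ^ 2 / c + 1 / 2) * β x ^ 2) * M ^ 2) volume :=
    ((integrable_const _).add (hβI.const_mul _)).mul_const _
  have hpt : ∀ x, c / 2 * du x ^ 2 ≤
      (ε ^ 2)⁻¹ * ((B x * u x - κ) * (dB x * u x + B x * du x)) +
      ((a₁ ^ 2 * K ^ 2 / c + K ^ 2 / 2) + (b₁ ^ 2 / c + 1 / 2) * β x ^ 2) * M ^ 2 := by
    intro x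
    have e1 : (ε ^ 2)⁻¹ * ((B x * u x - κ) * (dB x * u x + B x * du x)) =
        (a x * du x + β x * u x) * (dB x * u x + B x * du x) := by
      rw [← h.eq x]
      field_simp
    rw [e1]
    have ha := h.le_a x
    have ha1 := h.a_le x
    have hB := h.le_B x
    have hB1 := h.B_le x
    have hdB := h.abs_dB_le x
    have hu := h.u_nonneg x
    have huM := hM x
    have hdB2 : dB x ^ 2 ≤ K ^ 2 := sq_le_sq' (by linarith [neg_le_of_abs_le hdB])
      (le_of_abs_le hdB)
    have ha2 : a x ^ 2 ≤ a₁ ^ 2 := by gcongr; linarith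
    have hB2 : B x ^ 2 ≤ b₁ ^ 2 := by gcongr; linarith
    have hu2 : u x ^ 2 ≤ M ^ 2 := by gcongr
    have hca : c ≤ a x * B x := mul_le_mul ha hB hb₀.le (by linarith)
    have h1 : c * du x ^ 2 ≤ a x * B x * du x ^ 2 := by gcongr
    set s := a x * dB x + β x * B x with hs
    have h2 : s ^ 2 ≤ 2 * (a₁ ^ 2 * K ^ 2 + b₁ ^ 2 * β x ^ 2) := by
      have : s ^ 2 ≤ 2 * ((a x * dB x) ^ 2 + (β x * B x) ^ 2) := by
        rw [hs]
        nlinarith [sq_nonneg (a x * dB x - β x * B x)]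
      have h3 : (a x * dB x) ^ 2 ≤ a₁ ^ 2 * K ^ 2 := by
        rw [mul_pow]
        gcongr
      have h4 : (β x * B x) ^ 2 ≤ b₁ ^ 2 * β x ^ 2 := by
        rw [mul_pow, mul_comm]
        gcongr
      linarith
    -- Young's inequality, weighted so that half of the leading term absorbs the cross term.
    have h5 : -(s * (u x * du x)) ≤ c / 2 * du x ^ 2 + s ^ 2 * u x ^ 2 / (2 * c) := by
      have : 0 ≤ (c * du x + s * u x) ^ 2 / (2 * c) := by positivity
      have e : (c * du x + s * u x) ^ 2 / (2 * c) =
          c / 2 * du x ^ 2 + s ^ 2 * u x ^ 2 / (2 * c) + s * (u x * du x) := by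
        field_simp
        ring
      linarith
    have h6 : s ^ 2 * u x ^ 2 / (2 * c) ≤
        2 * (a₁ ^ 2 * K ^ 2 + b₁ ^ 2 * β x ^ 2) * M ^ 2 / (2 * c) := by gcongr
    have h7 : -(β x * dB x * u x ^ 2) ≤ (K ^ 2 + β x ^ 2) / 2 * M ^ 2 := by
      have h8 : -(β x * dB x) ≤ (K ^ 2 + β x ^ 2) / 2 := by
        nlinarith [sq_nonneg (β x + dB x)]
      calc -(β x * dB x * u x ^ 2) = -(β x * dB x) * u x ^ 2 := by ring
        _ ≤ (K ^ 2 + β x ^ 2) / 2 * u x ^ 2 := by gcongr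
        _ ≤ (K ^ 2 + β x ^ 2) / 2 * M ^ 2 := by gcongr
    have e2 : (a x * du x + β x * u x) * (dB x * u x + B x * du x) =
        a x * B x * du x ^ 2 + s * (u x * du x) + β x * dB x * u x ^ 2 := by
      rw [hs]
      ring
    have e3 : ((a₁ ^ 2 * K ^ 2 / c + K ^ 2 / 2) + (b₁ ^ 2 / c + 1 / 2) * β x ^ 2) * M ^ 2 =
        2 * (a₁ ^ 2 * K ^ 2 + b₁ ^ 2 * β x ^ 2) * M ^ 2 / (2 * c) +
        (K ^ 2 + β x ^ 2) / 2 * M ^ 2 := by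
      field_simp
      ring
    rw [e2, e3]
    linarith
  have h1 := integral_mono (h.memLp_du.integrable_sq.const_mul (c / 2)) (hEI.add hGI) hpt
  have h2 : ∫ x, ((ε ^ 2)⁻¹ * ((B x * u x - κ) * (dB x * u x + B x * du x)) +
      ((a₁ ^ 2 * K ^ 2 / c + K ^ 2 / 2) + (b₁ ^ 2 / c + 1 / 2) * β x ^ 2) * M ^ 2) =
      ((a₁ ^ 2 * K ^ 2 / c + K ^ 2 / 2) * T + (b₁ ^ 2 / c + 1 / 2) * ∫ x, β x ^ 2) * M ^ 2 := by
    rw [integral_add hEI hGI, hE0, zero_add, integral_mul_const,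
      integral_add (integrable_const _) (hβI.const_mul _), integral_const, measureReal_univ,
      integral_const_mul, smul_eq_mul, mul_comm T]
  rw [integral_const_mul] at h1
  have h3 := h1.trans h2.le
  have h4 : (b₁ ^ 2 / c + 1 / 2) * ∫ x, β x ^ 2 ≤ (b₁ ^ 2 / c + 1 / 2) * N := by
    have := h.integral_β_sq_le
    gcongr
  have h5 : c / 2 * ∫ x, du x ^ 2 ≤ ((a₁ ^ 2 * K ^ 2 / c + K ^ 2 / 2) * T +
      (b₁ ^ 2 / c + 1 / 2) * N) * M ^ 2 := by
    refine h3.trans ?_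
    gcongr
  unfold energyConst
  rw [← hc]
  calc ∫ x, du x ^ 2 = 2 / c * (c / 2 * ∫ x, du x ^ 2) := by field_simp
    _ ≤ 2 / c * (((a₁ ^ 2 * K ^ 2 / c + K ^ 2 / 2) * T + (b₁ ^ 2 / c + 1 / 2) * N) * M ^ 2) := by
      gcongr
    _ = _ := by ring

/-- The uniform upper bound of the density. -/
def supConst (T b₀ b₁ K a₀ a₁ N : ℝ) : ℝ :=
  2 / min T (1 / (4 * (energyConst T b₀ b₁ K a₀ a₁ N + 1)))

/-- Let `M` be the maximum. The energy bound `D M²` scales as `M²`, so over an arc of length `δ`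
with `δ D ≤ 1/4` starting at the maximum point, `u` drops by at most `√(δ D) M ≤ M / 2`. The arc
carries mass at least `δ M / 2`, whence `M ≤ 2 / δ`. -/
lemma u_le (h : DensityEquation B dB b₀ b₁ K a₀ a₁ N a β ε κ u du) (x : AddCircle T) :
    u x ≤ supConst T b₀ b₁ K a₀ a₁ N := by
  have hT : (0 : ℝ) < T := Fact.out
  have hD := h.energyConst_nonneg
  unfold supConst
  set D := energyConst T b₀ b₁ K a₀ a₁ N with hDdef
  set δ := min T (1 / (4 * (D + 1))) with hδ
  have hδ0 : 0 < δ := lt_min hT (by positivity)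
  have hδT : δ ≤ T := min_le_left _ _
  have hδD : δ * D ≤ 1 / 4 := by
    calc δ * D ≤ 1 / (4 * (D + 1)) * D := by
          gcongr
          exact min_le_right _ _
      _ ≤ 1 / 4 := by
          rw [div_mul_eq_mul_div, div_le_div_iff₀ (by positivity) (by norm_num)]
          linarith
  obtain ⟨z, -, hz⟩ := isCompact_univ.exists_isMaxOn univ_nonempty
    h.isPrimitive_u.continuous.continuousOn
  have hM : ∀ y, u y ≤ u z := fun y => hz (mem_univ y)
  refine (hM x).trans ?_
  obtain ⟨s, rfl⟩ := QuotientAddGroup.mk_surjective z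
  change u (s : AddCircle T) ≤ 2 / δ
  have hE := h.integral_du_sq_le hM
  have hM0 := h.u_nonneg (s : AddCircle T)
  have hlow : ∀ t ∈ Icc s (s + δ), u (s : AddCircle T) / 2 ≤ u (t : AddCircle T) := by
    intro t ht
    have h1 := h.isPrimitive_u.sq_sub_le h.memLp_du.integrable_sq ht.1 (by linarith [ht.2])
    have h2 : (u t - u s) ^ 2 ≤ (u s / 2) ^ 2 := by
      calc (u t - u s) ^ 2 ≤ (t - s) * ∫ x, du x ^ 2 := h1
        _ ≤ δ * (D * u s ^ 2) := by
          refine mul_le_mul (by linarith [ht.2]) hE (integral_nonneg fun _ => sq_nonneg _) hδ0.le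
        _ = δ * D * u s ^ 2 := by ring
        _ ≤ 1 / 4 * u s ^ 2 := by gcongr
        _ = (u s / 2) ^ 2 := by ring
    have h3 := abs_le_of_sq_le_sq' h2 (by positivity)
    linarith [h3.1]
  have huI := integrable_of_continuous h.isPrimitive_u.continuous volume
  have h1 : ∫ t in s..s + δ, u (s : AddCircle T) / 2 ≤ ∫ t in s..s + δ, u (t : AddCircle T) :=
    intervalIntegral.integral_mono_on (by linarith) intervalIntegrable_const
      (intervalIntegrable_lift huI _ _) hlow
  have h2 := intervalIntegral_le_integral huI h.u_nonneg (x := s) (y := s + δ) (by linarith)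
    (by linarith)
  rw [intervalIntegral.integral_const, smul_eq_mul, add_sub_cancel_left] at h1
  rw [h.integral_u] at h2
  rw [le_div_iff₀ hδ0]
  linarith

/-- The uniform bound of the Dirichlet energy of the density. -/
def dirichletConst (T b₀ b₁ K a₀ a₁ N : ℝ) : ℝ :=
  energyConst T b₀ b₁ K a₀ a₁ N * supConst T b₀ b₁ K a₀ a₁ N ^ 2

lemma integral_du_sq_le_dirichletConst
    (h : DensityEquation B dB b₀ b₁ K a₀ a₁ N a β ε κ u du) :
    ∫ x, du x ^ 2 ≤ dirichletConst T b₀ b₁ K a₀ a₁ N :=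
  h.integral_du_sq_le h.u_le

/-- A bound for `ε⁻⁴ ∫ (B u - κ)²`. -/
def fluxConst (T b₀ b₁ K a₀ a₁ N : ℝ) : ℝ :=
  2 * a₁ ^ 2 * dirichletConst T b₀ b₁ K a₀ a₁ N + 2 * supConst T b₀ b₁ K a₀ a₁ N ^ 2 * N

/-- A bound for `∫ ((B u)')²`. -/
def fluxDerivConst (T b₀ b₁ K a₀ a₁ N : ℝ) : ℝ :=
  2 * K ^ 2 * supConst T b₀ b₁ K a₀ a₁ N ^ 2 * T + 2 * b₁ ^ 2 * dirichletConst T b₀ b₁ K a₀ a₁ N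

/-- The equation writes the flux as `ε² (a u' + β u)`, and the bracket is bounded in `L²` uniformly
in `ε`. -/
lemma integral_flux_sq_le (h : DensityEquation B dB b₀ b₁ K a₀ a₁ N a β ε κ u du) :
    ∫ x, (B x * u x - κ) ^ 2 ≤ ε ^ 4 * fluxConst T b₀ b₁ K a₀ a₁ N := by
  set M := supConst T b₀ b₁ K a₀ a₁ N with hM
  have hw := h.isPrimitive_flux
  have hI1 := h.memLp_du.integrable_sq
  have hI2 := h.memLp_β.integrable_sq
  have h1 : ∫ x, (B x * u x - κ) ^ 2 ≤
      ∫ x, ε ^ 4 * (2 * a₁ ^ 2 * du x ^ 2 + 2 * M ^ 2 * β x ^ 2) := by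
    refine integral_mono (integrable_of_continuous (hw.continuous.pow 2) _)
      (((hI1.const_mul _).add (hI2.const_mul _)).const_mul _) fun x => ?_
    have ha1 := h.a_le x
    have ha : 0 ≤ a x := h.a₀_pos.le.trans (h.le_a x)
    have hu := h.u_nonneg x
    have huM := h.u_le x
    simp only
    rw [← h.eq x]
    have e : (ε ^ 2 * (a x * du x + β x * u x)) ^ 2 = ε ^ 4 * (a x * du x + β x * u x) ^ 2 := by
      ring
    rw [e]
    have h2 : (a x * du x + β x * u x) ^ 2 ≤ 2 * a x ^ 2 * du x ^ 2 + 2 * u x ^ 2 * β x ^ 2 := by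
      nlinarith [sq_nonneg (a x * du x - β x * u x)]
    have h3 : 2 * a x ^ 2 * du x ^ 2 + 2 * u x ^ 2 * β x ^ 2 ≤
        2 * a₁ ^ 2 * du x ^ 2 + 2 * M ^ 2 * β x ^ 2 := by gcongr
    have h4 := h2.trans h3
    gcongr
  refine h1.trans ?_
  rw [integral_const_mul, integral_add (hI1.const_mul _) (hI2.const_mul _), integral_const_mul,
    integral_const_mul, fluxConst, ← hM]
  have h5 := h.integral_du_sq_le_dirichletConst
  have h6 := h.integral_β_sq_le
  gcongr

lemma integral_flux_deriv_sq_le (h : DensityEquation B dB b₀ b₁ K a₀ a₁ N a β ε κ u du) :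
    ∫ x, (dB x * u x + B x * du x) ^ 2 ≤ fluxDerivConst T b₀ b₁ K a₀ a₁ N := by
  set M := supConst T b₀ b₁ K a₀ a₁ N with hM
  have hI1 := h.memLp_du.integrable_sq
  have h1 : ∫ x, (dB x * u x + B x * du x) ^ 2 ≤
      ∫ x, (2 * K ^ 2 * M ^ 2 + 2 * b₁ ^ 2 * du x ^ 2) := by
    refine integral_mono h.memLp_flux_deriv.integrable_sq
      ((integrable_const _).add (hI1.const_mul _)) fun x => ?_
    have hB1 := h.B_le x
    have hB : 0 ≤ B x := h.b₀_pos.le.trans (h.le_B x)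
    have hdB := h.abs_dB_le x
    have hu := h.u_nonneg x
    have huM := h.u_le x
    have hdB2 : dB x ^ 2 ≤ K ^ 2 := sq_le_sq' (by linarith [neg_le_of_abs_le hdB])
      (le_of_abs_le hdB)
    have h2 : (dB x * u x + B x * du x) ^ 2 ≤ 2 * dB x ^ 2 * u x ^ 2 + 2 * B x ^ 2 * du x ^ 2 := by
      nlinarith [sq_nonneg (dB x * u x - B x * du x)]
    refine h2.trans ?_
    gcongr
  refine h1.trans ?_
  rw [integral_add (integrable_const _) (hI1.const_mul _), integral_const, measureReal_univ,
    integral_const_mul, smul_eq_mul, fluxDerivConst, ← hM, mul_comm T]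
  have h5 := h.integral_du_sq_le_dirichletConst
  gcongr

/-- The constant in the estimate `|B u - κ|² ≤ C ε²`. -/
def rateConst (T b₀ b₁ K a₀ a₁ N ε₀ : ℝ) : ℝ :=
  (ε₀ ^ 2 / T + 1) * fluxConst T b₀ b₁ K a₀ a₁ N + fluxDerivConst T b₀ b₁ K a₀ a₁ N

/-- With `w = B u - κ`, Young's inequality `2 w w' ≤ ε⁻² w² + ε² w'²` balances `∫ w² = O(ε⁴)`
against `∫ w'² = O(1)`, so `w²` oscillates by `O(ε²)`. Averaging over the base point adds the mean
of `w²`, which is of order `ε⁴ ≤ ε² ε₀²`. -/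
lemma flux_sq_le (h : DensityEquation B dB b₀ b₁ K a₀ a₁ N a β ε κ u du) {ε₀ : ℝ} (hε₀ : ε ≤ ε₀)
    (x : AddCircle T) :
    (B x * u x - κ) ^ 2 ≤ ε ^ 2 * rateConst T b₀ b₁ K a₀ a₁ N ε₀ := by
  have hT : (0 : ℝ) < T := Fact.out
  have hε := h.ε_pos
  have hw := h.isPrimitive_flux
  have hwI : Integrable (fun x => (B x * u x - κ) ^ 2) volume :=
    integrable_of_continuous (hw.continuous.pow 2) volume
  have hdI := h.memLp_flux_deriv.integrable_sq
  set Q := fluxConst T b₀ b₁ K a₀ a₁ N with hQ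
  set R := fluxDerivConst T b₀ b₁ K a₀ a₁ N with hR
  have hQ1 := h.integral_flux_sq_le
  have hR1 := h.integral_flux_deriv_sq_le
  rw [← hQ] at hQ1
  rw [← hR] at hR1
  have hQ0 : 0 ≤ Q := by
    have h0 : 0 ≤ ∫ x, (B x * u x - κ) ^ 2 := integral_nonneg fun _ => sq_nonneg _
    have : 0 < ε ^ 4 := by positivity
    exact nonneg_of_mul_nonneg_right (h0.trans hQ1) this
  have hosc : ∀ y, (B x * u x - κ) * (B x * u x - κ) - (B y * u y - κ) * (B y * u y - κ) ≤
      ε ^ 2 * (Q + R) := by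
    intro y
    have hpt : ∀ z, (dB z * u z + B z * du z) * (B z * u z - κ) +
        (B z * u z - κ) * (dB z * u z + B z * du z) ≤
        (ε ^ 2)⁻¹ * (B z * u z - κ) ^ 2 + ε ^ 2 * (dB z * u z + B z * du z) ^ 2 := by
      intro z
      generalize B z * u z - κ = w
      generalize dB z * u z + B z * du z = w'
      have : 0 ≤ (w - ε ^ 2 * w') ^ 2 / ε ^ 2 := by positivity
      have e : (w - ε ^ 2 * w') ^ 2 / ε ^ 2 =
          (ε ^ 2)⁻¹ * w ^ 2 + ε ^ 2 * w' ^ 2 - (w' * w + w * w') := by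
        field_simp
        ring
      linarith
    have hsum : Integrable (fun z => (ε ^ 2)⁻¹ * (B z * u z - κ) ^ 2 +
        ε ^ 2 * (dB z * u z + B z * du z) ^ 2) volume :=
      (hwI.const_mul _).add (hdI.const_mul _)
    have h1 := (hw.mul hw).sub_le_of_le hsum (fun z => by positivity) hpt y x
    refine h1.trans ?_
    rw [integral_add (hwI.const_mul _) (hdI.const_mul _), integral_const_mul, integral_const_mul]
    have h2 : (ε ^ 2)⁻¹ * ∫ x, (B x * u x - κ) ^ 2 ≤ (ε ^ 2)⁻¹ * (ε ^ 4 * Q) := by gcongr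
    have h3 : (ε ^ 2)⁻¹ * (ε ^ 4 * Q) = ε ^ 2 * Q := by field_simp
    have h4 : ε ^ 2 * ∫ x, (dB x * u x + B x * du x) ^ 2 ≤ ε ^ 2 * R := by gcongr
    linarith
  have h1 : ∫ _ : AddCircle T, (B x * u x - κ) ^ 2 ≤
      ∫ y, ((B y * u y - κ) ^ 2 + ε ^ 2 * (Q + R)) :=
    integral_mono (integrable_const _) (hwI.add (integrable_const _)) fun y => by
      have := hosc y
      simp only
      nlinarith
  rw [integral_add hwI (integrable_const _), integral_const, integral_const, measureReal_univ,
    smul_eq_mul, smul_eq_mul] at h1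
  have h2 : ε ^ 4 * Q ≤ ε ^ 2 * ε₀ ^ 2 * Q := by
    have : ε ^ 4 = ε ^ 2 * ε ^ 2 := by ring
    rw [this]
    gcongr
  have h3 : T * (B x * u x - κ) ^ 2 ≤ T * (ε ^ 2 * rateConst T b₀ b₁ K a₀ a₁ N ε₀) := by
    have e : T * (ε ^ 2 * rateConst T b₀ b₁ K a₀ a₁ N ε₀) =
        ε ^ 2 * ε₀ ^ 2 * Q + T * (ε ^ 2 * (Q + R)) := by
      rw [rateConst, ← hQ, ← hR]
      field_simp
      ring
    linarith
  exact le_of_mul_le_mul_left h3 hT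

/-- Dividing the flux by `B` and integrating, with unit mass, shows that `κ` is within the flux
error of `(∫ 1 / B)⁻¹`. The factor `2` counts the flux error once for `B u - κ` and once for `κ`. -/
lemma abs_sub_limit_le (h : DensityEquation B dB b₀ b₁ K a₀ a₁ N a β ε κ u du) {ε₀ : ℝ}
    (hε₀ : ε ≤ ε₀) (x : AddCircle T) :
    |u x - (∫ y, 1 / B y)⁻¹ / B x| ≤ 2 * √(rateConst T b₀ b₁ K a₀ a₁ N ε₀) / b₀ * ε := by
  have hT : (0 : ℝ) < T := Fact.out
  have hε := h.ε_pos
  have hb₀ := h.b₀_pos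
  have hBpos : ∀ y, 0 < B y := fun y => hb₀.trans_le (h.le_B y)
  set s := √(rateConst T b₀ b₁ K a₀ a₁ N ε₀) * ε with hs
  have hs0 : 0 ≤ s := by positivity
  have hw : ∀ y, |B y * u y - κ| ≤ s := by
    intro y
    have h1 := Real.sqrt_le_sqrt (h.flux_sq_le hε₀ y)
    rw [Real.sqrt_sq_eq_abs, Real.sqrt_mul (sq_nonneg ε), Real.sqrt_sq hε.le] at h1
    linarith
  have hBi : Continuous fun y => 1 / B y :=
    continuous_const.div h.isPrimitive_B.continuous fun y => (hBpos y).ne'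
  have hBI := integrable_of_continuous hBi volume
  set I := ∫ y, 1 / B y with hI
  have hIpos : 0 < I := by
    have h1 : ∫ _ : AddCircle T, 1 / b₁ ≤ I := integral_mono (integrable_const _) hBI fun y =>
      one_div_le_one_div_of_le (hBpos y) (h.B_le y)
    rw [integral_const, measureReal_univ, smul_eq_mul] at h1
    have : 0 < b₁ := (hBpos 0).trans_le (h.B_le 0)
    have h2 : 0 < T * (1 / b₁) := by positivity
    linarith
  have hk : |κ * I - 1| ≤ s * I := by
    have huI := integrable_of_continuous h.isPrimitive_u.continuous volume
    have e : κ * I - 1 = ∫ y, (κ * (1 / B y) - u y) := by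
      rw [integral_sub (hBI.const_mul _) huI, integral_const_mul, h.integral_u]
    rw [e, ← integral_const_mul]
    refine (abs_integral_le_integral_abs).trans (integral_mono
      ((hBI.const_mul _).sub huI).abs (hBI.const_mul _) fun y => ?_)
    have e2 : κ * (1 / B y) - u y = -((B y * u y - κ) * (1 / B y)) := by
      have := (hBpos y).ne'
      field_simp
      ring
    simp only
    rw [e2, abs_neg, abs_mul, abs_of_pos (one_div_pos.2 (hBpos y))]
    have := hw y
    have := hBpos y
    gcongr
  have hk2 : |κ - I⁻¹| ≤ s := by
    have e : κ - I⁻¹ = (κ * I - 1) / I := by field_simp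
    rw [e, abs_div, abs_of_pos hIpos, div_le_iff₀ hIpos]
    exact hk
  have e : u x - I⁻¹ / B x = ((B x * u x - κ) + (κ - I⁻¹)) / B x := by
    have := (hBpos x).ne'
    field_simp
    ring
  rw [e, abs_div, abs_of_pos (hBpos x), div_le_iff₀ (hBpos x)]
  have h1 : |(B x * u x - κ) + (κ - I⁻¹)| ≤ 2 * s := by
    have := abs_add_le (B x * u x - κ) (κ - I⁻¹)
    linarith [hw x]
  refine h1.trans ?_
  have e3 : 2 * √(rateConst T b₀ b₁ K a₀ a₁ N ε₀) / b₀ * ε * B x = 2 * s * (B x / b₀) := by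
    rw [hs]
    ring
  rw [e3]
  have : 1 ≤ B x / b₀ := by
    rw [le_div_iff₀ hb₀, one_mul]
    exact h.le_B x
  nlinarith

/-- The Harnack exponent for noise intensities `ε ≥ ε₁`. -/
def harnackConst (T b₁ a₀ N ε₁ : ℝ) : ℝ :=
  a₀⁻¹ * ((b₁ / ε₁ ^ 2 + 1 / 2) * T + N / 2)

/-- The logarithmic derivative of `u` is a term bounded by the integrable `g`, minus `κ` times a
positive term that is not controlled where `u` is small. That term has constant sign, so the
logarithm can be compared by traversing the circle in the favourable direction. The shift `η` is
needed because `u` is not yet known to be positive. -/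
lemma harnack (h : DensityEquation B dB b₀ b₁ K a₀ a₁ N a β ε κ u du) {ε₁ : ℝ} (hε₁ : 0 < ε₁)
    (hε : ε₁ ≤ ε) (x y : AddCircle T) :
    u y ≤ Real.exp (harnackConst T b₁ a₀ N ε₁) * u x := by
  set Q := harnackConst T b₁ a₀ N ε₁ with hQ
  have ha₀ := h.a₀_pos
  have hβI := h.memLp_β.integrable_sq
  set g : AddCircle T → ℝ := fun z => a₀⁻¹ * ((b₁ / ε₁ ^ 2 + 1 / 2) + 1 / 2 * β z ^ 2) with hg
  have hgI : Integrable g volume := ((integrable_const _).add (hβI.const_mul _)).const_mul _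
  have hb₁ : 0 < b₁ := h.b₀_pos.trans_le ((h.le_B 0).trans (h.B_le 0))
  have hg0 : ∀ z, 0 ≤ g z := fun z => by positivity
  have hgQ : ∫ z, g z ≤ Q := by
    rw [hg, integral_const_mul, integral_add (integrable_const _) (hβI.const_mul _),
      integral_const, measureReal_univ, integral_const_mul, smul_eq_mul, hQ, harnackConst]
    have := h.integral_β_sq_le
    have h1 : T * (b₁ / ε₁ ^ 2 + 1 / 2) + 1 / 2 * ∫ x, β x ^ 2 ≤
        (b₁ / ε₁ ^ 2 + 1 / 2) * T + N / 2 := by linarith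
    gcongr
  -- Logarithmic derivative of `u + η`.
  have hlog : ∀ η > 0, ∀ z, ∃ q, |q| ≤ g z ∧
      (u z + η)⁻¹ * du z = q - κ * ((a z)⁻¹ * (ε ^ 2)⁻¹ * (u z + η)⁻¹) := by
    intro η hη z
    have hu := h.u_nonneg z
    have hB := h.B_le z
    have hB0 : 0 < B z := h.b₀_pos.trans_le (h.le_B z)
    have ha := h.le_a z
    have ha0 : 0 < a z := ha₀.trans_le ha
    refine ⟨(a z)⁻¹ * ((B z / ε ^ 2 - β z) * (u z / (u z + η))), ?_, ?_⟩
    · have h1 : |(a z)⁻¹| ≤ a₀⁻¹ := by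
        rw [abs_of_pos (inv_pos.2 ha0)]
        gcongr
      have h2 : |u z / (u z + η)| ≤ 1 := by
        rw [abs_of_nonneg (by positivity), div_le_one (by positivity)]
        linarith
      have h3 : |B z / ε ^ 2 - β z| ≤ (b₁ / ε₁ ^ 2 + 1 / 2) + 1 / 2 * β z ^ 2 := by
        have h4 : |B z / ε ^ 2| ≤ b₁ / ε₁ ^ 2 := by
          rw [abs_of_nonneg (by positivity)]
          gcongr
        have h5 : |β z| ≤ 1 / 2 + 1 / 2 * β z ^ 2 := by
          rw [← sq_abs (β z)]
          nlinarith [sq_nonneg (|β z| - 1)]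
        have := abs_sub (B z / ε ^ 2) (β z)
        linarith
      rw [abs_mul, abs_mul, hg]
      refine mul_le_mul h1 ?_ (by positivity) (by positivity)
      calc |B z / ε ^ 2 - β z| * |u z / (u z + η)| ≤ |B z / ε ^ 2 - β z| * 1 := by gcongr
        _ ≤ _ := by rwa [mul_one]
    · rw [h.du_eq z]
      have := h.ε_pos.ne'
      field_simp
      ring
  have key : ∀ η > 0, u y + η ≤ Real.exp Q * (u x + η) := by
    intro η hη
    have hp : IsPrimitive (fun z => u z + η) du := by
      simpa using h.isPrimitive_u.add (.const η)
    have hl := hp.log hη fun z => by linarith [h.u_nonneg z]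
    have hpos : ∀ z, 0 < u z + η := fun z => by linarith [h.u_nonneg z]
    have hterm : ∀ z, 0 ≤ (a z)⁻¹ * (ε ^ 2)⁻¹ * (u z + η)⁻¹ := fun z => by
      have h1 : 0 < a z := ha₀.trans_le (h.le_a z)
      have h2 := hpos z
      positivity
    have hd : Real.log (u y + η) - Real.log (u x + η) ≤ Q := by
      refine le_trans ?_ hgQ
      -- If `κ ≥ 0` the logarithmic derivative is at most `g`, and the path runs from `x` to `y`. If
      -- `κ ≤ 0` it is at least `-g`, and the negated logarithm is followed from `y` to `x`.
      rcases le_total 0 κ with hκ | hκ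
      · refine hl.sub_le_of_le hgI hg0 (fun z => ?_) x y
        obtain ⟨q, hq, e⟩ := hlog η hη z
        rw [e]
        have := mul_nonneg hκ (hterm z)
        linarith [le_abs_self q]
      · have hl' := hl.const_mul (-1)
        have := hl'.sub_le_of_le hgI hg0 (fun z => ?_) y x
        · linarith
        obtain ⟨q, hq, e⟩ := hlog η hη z
        rw [e]
        have := mul_nonneg (neg_nonneg.2 hκ) (hterm z)
        linarith [neg_le_abs q]
    have h1 : Real.log (u y + η) ≤ Q + Real.log (u x + η) := by linarith
    rw [Real.log_le_iff_le_exp (hpos y), Real.exp_add, Real.exp_log (hpos x)] at h1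
    exact h1
  have hlim : Tendsto (fun η : ℝ => Real.exp Q * (u x + η) - (u y + η)) (𝓝[>] 0)
      (𝓝 (Real.exp Q * (u x + 0) - (u y + 0))) := by
    refine Tendsto.mono_left (Continuous.tendsto ?_ 0) nhdsWithin_le_nhds
    fun_prop
  have := ge_of_tendsto hlim (b := 0) (by
    filter_upwards [self_mem_nhdsWithin] with η hη
    linarith [key η hη])
  simp only [add_zero] at this
  linarith

lemma exp_neg_harnackConst_le (h : DensityEquation B dB b₀ b₁ K a₀ a₁ N a β ε κ u du) {ε₁ : ℝ}
    (hε₁ : 0 < ε₁) (hε : ε₁ ≤ ε) (x : AddCircle T) :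
    Real.exp (-harnackConst T b₁ a₀ N ε₁) / T ≤ u x := by
  have hT : (0 : ℝ) < T := Fact.out
  have huI := integrable_of_continuous h.isPrimitive_u.continuous volume
  have h1 : ∫ y, u y ≤ ∫ _ : AddCircle T, Real.exp (harnackConst T b₁ a₀ N ε₁) * u x :=
    integral_mono huI (integrable_const _) fun y => h.harnack hε₁ hε x y
  rw [h.integral_u, integral_const, measureReal_univ, smul_eq_mul] at h1
  rw [Real.exp_neg, div_le_iff₀ hT, inv_le_iff_one_le_mul₀ (Real.exp_pos _)]
  linarith

end DensityEquation

/-! ### Convergence in Hölder and Sobolev spaces -/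

lemma IsPrimitive.holderWith_half {F f : AddCircle T → ℝ} (h : IsPrimitive F f) {D : ℝ}
    (hf : Integrable (fun x => f x ^ 2) volume) (hD : ∫ x, f x ^ 2 ≤ D) :
    HolderWith (√D).toNNReal (1 / 2) F := by
  have hT : (0 : ℝ) < T := Fact.out
  intro x y
  have hD0 : 0 ≤ D := (integral_nonneg fun _ => sq_nonneg _).trans hD
  have key : |F x - F y| ≤ √D * dist x y ^ (1 / 2 : ℝ) := by
    obtain ⟨s, t, rfl, rfl, hst⟩ := exists_coe_dist x y
    have hle : |t - s| ≤ T := by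
      rw [hst]
      linarith [dist_le_half (s : AddCircle T) t]
    have hsq : (F s - F t) ^ 2 ≤ D * |t - s| := by
      have hN : 0 ≤ |t - s| := abs_nonneg _
      rcases le_total s t with h1 | h1
      · rw [abs_of_nonneg (sub_nonneg.2 h1)] at hle hN ⊢
        have h2 := h.sq_sub_le hf h1 (by linarith)
        nlinarith
      · rw [abs_of_nonpos (sub_nonpos.2 h1)] at hle hN ⊢
        have h2 := h.sq_sub_le hf h1 (by linarith)
        nlinarith
    rw [← hst, ← Real.sqrt_eq_rpow, ← Real.sqrt_mul hD0]
    exact Real.abs_le_sqrt hsq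
  rw [edist_dist, edist_dist, Real.dist_eq, ENNReal.ofReal_rpow_of_nonneg dist_nonneg (by simp)]
  change _ ≤ ENNReal.ofReal (√D) * _
  rw [← ENNReal.ofReal_mul (Real.sqrt_nonneg _)]
  refine ENNReal.ofReal_le_ofReal ?_
  simpa using key

/-- Interpolation between the oscillation bound `2 s` (exponent `0`) and the Hölder-1/2 bound `√D`,
with weights `1 - 2 α` and `2 α`. -/
lemma IsPrimitive.cAlphaNorm_le {F f : AddCircle T → ℝ} (h : IsPrimitive F f) {D s : ℝ}
    (hf : Integrable (fun x => f x ^ 2) volume) (hD : ∫ x, f x ^ 2 ≤ D) (hs : ∀ x, |F x| ≤ s)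
    {α : ℝ≥0} (hα : α < 1 / 2) :
    cAlphaNorm α F ≤ s.toNNReal + ((2 * s).toNNReal ^ ((1 - 2 * α : ℝ≥0) : ℝ) *
      (√D).toNNReal ^ ((2 * α : ℝ≥0) : ℝ) : ℝ≥0) := by
  have h2α : 2 * α ≤ 1 := by
    have : 2 * α ≤ 2 * (1 / 2) := by gcongr
    simpa using this
  have h0 : HolderWith (2 * s).toNNReal 0 F := by
    intro x y
    simp only [NNReal.coe_zero, ENNReal.rpow_zero, mul_one]
    rw [edist_dist, Real.dist_eq]
    change _ ≤ ENNReal.ofReal (2 * s)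
    refine ENNReal.ofReal_le_ofReal ?_
    have := abs_sub (F x) (F y)
    linarith [hs x, hs y]
  have h1 := holderOnWith_univ.1 ((holderOnWith_univ.2 h0).interpolate
    (holderOnWith_univ.2 (h.holderWith_half hf hD)) (tsub_add_cancel_of_le h2α))
  have e : (0 : ℝ≥0) * (1 - 2 * α) + 1 / 2 * (2 * α) = α := by
    rw [zero_mul, zero_add, ← mul_assoc]
    norm_num
  rw [e] at h1
  refine add_le_add (iSup_le fun x => ?_) h1.eHolderNorm_le
  rw [Real.enorm_eq_ofReal_abs]
  exact ENNReal.ofReal_le_ofReal (hs x)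

lemma eLpNorm_two_le {f : AddCircle T → ℝ} (hf : MemLp f 2 volume) {D : ℝ}
    (hD : ∫ x, f x ^ 2 ≤ D) : eLpNorm f 2 volume ≤ ENNReal.ofReal (√D) := by
  rw [hf.eLpNorm_eq_integral_rpow_norm (by norm_num) (by norm_num)]
  refine ENNReal.ofReal_le_ofReal ?_
  rw [Real.sqrt_eq_rpow]
  have e : ∀ x, ‖f x‖ ^ (2 : ℝ≥0∞).toReal = f x ^ 2 := fun x => by
    rw [ENNReal.toReal_ofNat, Real.rpow_ofNat, Real.norm_eq_abs, sq_abs]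
  simp only [e]
  have e2 : (2 : ℝ≥0∞).toReal⁻¹ = 1 / 2 := by norm_num
  rw [e2]
  exact Real.rpow_le_rpow (integral_nonneg fun _ => sq_nonneg _) hD (by norm_num)

/-- The element of `W^{1,2}` given by a function and its weak derivative. -/
def mkW12 {f g : AddCircle T → ℝ} (h : HasWeakDeriv f g) (hf : MemLp f 2 volume)
    (hg : MemLp g 2 volume) : W12 T :=
  ⟨WithLp.toLp 2 (hf.toLp f, hg.toLp g),
    h.congr (MemLp.coeFn_toLp hf).symm (MemLp.coeFn_toLp hg).symm⟩

lemma norm_mkW12_le {f g : AddCircle T → ℝ} (h : HasWeakDeriv f g) (hf : MemLp f 2 volume)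
    (hg : MemLp g 2 volume) {C D : ℝ} (hC : ∫ x, f x ^ 2 ≤ C) (hD : ∫ x, g x ^ 2 ≤ D) :
    ‖mkW12 h hf hg‖ ≤ √(C + D) := by
  have hC0 : 0 ≤ C := (integral_nonneg fun _ => sq_nonneg _).trans hC
  have hD0 : 0 ≤ D := (integral_nonneg fun _ => sq_nonneg _).trans hD
  refine Real.le_sqrt_of_sq_le ?_
  change ‖(WithLp.toLp 2 (hf.toLp f, hg.toLp g) : WithLp 2 (_ × _))‖ ^ 2 ≤ _
  rw [WithLp.prod_norm_sq_eq_of_L2]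
  have key : ∀ {f : AddCircle T → ℝ} (hf : MemLp f 2 volume) {C : ℝ}, 0 ≤ C →
      ∫ x, f x ^ 2 ≤ C → ‖hf.toLp f‖ ^ 2 ≤ C := by
    intro f hf C hC0 hC
    have h1 := eLpNorm_two_le hf hC
    rw [Lp.norm_toLp]
    have h2 := ENNReal.toReal_mono ENNReal.ofReal_ne_top h1
    rw [ENNReal.toReal_ofReal (Real.sqrt_nonneg _)] at h2
    calc _ ≤ √C ^ 2 := by gcongr
      _ = C := Real.sq_sqrt hC0
  exact add_le_add (key hf hC0 hC) (key hg hD0 hD)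

lemma inner_toLp_eq {φ : AddCircle T → ℝ} (hφ : MemLp φ 2 volume)
    (f : Lp ℝ 2 (volume : Measure (AddCircle T))) :
    inner ℝ (hφ.toLp φ) f = ∫ x, f x * φ x := by
  rw [L2.inner_def]
  refine integral_congr_ae ?_
  filter_upwards [hφ.coeFn_toLp] with x hx
  rw [hx]
  simp

lemma mem_W12_iff {w : WithLp 2 (Lp ℝ 2 (volume : Measure (AddCircle T)) ×
    Lp ℝ 2 (volume : Measure (AddCircle T)))} :
    w ∈ W12 T ↔ HasWeakDeriv (w.fst : AddCircle T → ℝ) (w.snd : AddCircle T → ℝ) := by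
  change w ∈ {w : WithLp 2 (Lp ℝ 2 (volume : Measure (AddCircle T)) ×
    Lp ℝ 2 (volume : Measure (AddCircle T))) | HasWeakDeriv (w.fst : AddCircle T → ℝ)
      (w.snd : AddCircle T → ℝ)} ↔ _
  rw [mem_ofPred_eq]

/-- Each test function imposes one condition that is continuous in the pair. Closedness gives
completeness, required for adjoints and the Riesz representation. -/
lemma isClosed_W12 : IsClosed (W12 T : Set (WithLp 2 (Lp ℝ 2 (volume : Measure (AddCircle T)) ×
    Lp ℝ 2 (volume : Measure (AddCircle T))))) := by
  have hLI : ∀ f : Lp ℝ 2 (volume : Measure (AddCircle T)),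
      Integrable (f : AddCircle T → ℝ) volume := fun f => (Lp.memLp f).integrable (by norm_num)
  have e : (W12 T : Set (WithLp 2 (Lp ℝ 2 (volume : Measure (AddCircle T)) ×
      Lp ℝ 2 (volume : Measure (AddCircle T))))) =
      ⋂ (φ : AddCircle T → ℝ) (hφ : IsCn (⊤ : ℕ∞) φ),
        {w | inner ℝ ((DensityEquation.memLp_of_continuous
            (hφ.continuous_circleDeriv le_top) 2).toLp _) w.fst =
          -inner ℝ ((DensityEquation.memLp_of_continuous hφ.continuous 2).toLp _) w.snd} := by
    ext w
    simp only [SetLike.mem_coe, mem_W12_iff, mem_iInter, mem_ofPred_eq, inner_toLp_eq]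
    exact ⟨fun h => h.integral_eq, fun h => ⟨hLI _, hLI _, h⟩⟩
  rw [e]
  refine isClosed_iInter fun φ => isClosed_iInter fun hφ => isClosed_eq ?_ ?_
  · exact continuous_const.inner (WithLp.continuous_fst _ _ _)
  · exact (continuous_const.inner (WithLp.continuous_snd _ _ _)).neg

instance : CompleteSpace (W12 T) := isClosed_W12.completeSpace_coe

/-- The embedding of `W^{1,2}` into `L²`. -/
def toL2 (T : ℝ) [Fact (0 < T)] : W12 T →L[ℝ] Lp ℝ 2 (volume : Measure (AddCircle T)) :=
  (WithLp.fstL 2 ℝ _ _).comp (W12 T).subtypeL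

lemma toL2_injective : Function.Injective (toL2 T) := by
  rw [injective_iff_map_eq_zero]
  intro w hw
  have h1 : w.1.fst = 0 := hw
  have h2 := mem_W12_iff.1 w.2
  have h3 : (w.1.snd : AddCircle T → ℝ) =ᵐ[volume] 0 := by
    refine HasWeakDeriv.ae_unique (h2.congr ?_ .rfl) HasWeakDeriv.zero
    rw [h1]
    exact Lp.coeFn_zero _ _ _
  have h4 : w.1.snd = 0 := (Lp.eq_zero_iff_ae_eq_zero).2 h3
  exact Subtype.ext ((WithLp.ofLp_injective 2) (Prod.ext h1 h4))

/-- A bounded family in a Hilbert space converges weakly as soon as its image under some injective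
bounded operator converges strongly. -/
lemma tendsto_inner_of_injective {E F ι : Type*} [NormedAddCommGroup E] [InnerProductSpace ℝ E]
    [CompleteSpace E] [NormedAddCommGroup F] [InnerProductSpace ℝ F] [CompleteSpace F]
    (L : E →L[ℝ] F) (hL : Function.Injective L) {l : Filter ι} {U : ι → E} {U₀ : E} {R : ℝ}
    (hR : ∀ᶠ i in l, ‖U i - U₀‖ ≤ R) (hU : Tendsto (fun i => L (U i)) l (𝓝 (L U₀))) (w : E) :
    Tendsto (fun i => inner ℝ w (U i)) l (𝓝 (inner ℝ w U₀)) := by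
  -- The orthogonal complement of the range of the adjoint is the kernel of `L`. Hence `w` is
  -- approximated by some `L* v`, against which strong convergence of `L (U i)` suffices;
  -- boundedness handles the error.
  have hdense : (ContinuousLinearMap.adjoint L).range.topologicalClosure = ⊤ := by
    rw [Submodule.topologicalClosure_eq_top_iff, ContinuousLinearMap.orthogonal_range,
      ContinuousLinearMap.adjoint_adjoint]
    exact LinearMap.ker_eq_bot.2 hL
  have hw : w ∈ closure ((ContinuousLinearMap.adjoint L).range : Set E) := by
    rw [← Submodule.topologicalClosure_coe, hdense]
    trivial
  rw [Metric.tendsto_nhds]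
  intro η hη
  have hR1 : 0 < max R 0 + 1 := by positivity
  obtain ⟨_, ⟨v, rfl⟩, hv⟩ := Metric.mem_closure_iff.1 hw (η / 2 / (max R 0 + 1)) (by positivity)
  have hlim : Tendsto (fun i => inner ℝ v (L (U i) - L U₀)) l (𝓝 0) := by
    have h1 : Tendsto (fun i => L (U i) - L U₀) l (𝓝 0) := by
      simpa using hU.sub_const (L U₀)
    simpa using (tendsto_const_nhds (x := v)).inner (𝕜 := ℝ) h1
  filter_upwards [hR, (Metric.tendsto_nhds.1 hlim) (η / 2) (by positivity)] with i hi hi2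
  rw [Real.dist_eq, ← inner_sub_right]
  have e : inner ℝ w (U i - U₀) = inner ℝ (w - ContinuousLinearMap.adjoint L v) (U i - U₀) +
      inner ℝ v (L (U i) - L U₀) := by
    rw [inner_sub_left, ContinuousLinearMap.adjoint_inner_left, map_sub]
    ring
  rw [e]
  rw [Real.dist_eq, sub_zero] at hi2
  have h1 : |inner ℝ (w - ContinuousLinearMap.adjoint L v) (U i - U₀)| ≤
      η / 2 / (max R 0 + 1) * (max R 0 + 1) := by
    refine (abs_real_inner_le_norm _ _).trans ?_
    rw [dist_eq_norm] at hv
    refine mul_le_mul hv.le (hi.trans ?_) (norm_nonneg _) (by positivity)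
    linarith [le_max_left R 0]
  rw [div_mul_cancel₀ _ hR1.ne'] at h1
  refine (abs_add_le _ _).trans_lt ?_
  change |inner ℝ (w - ContinuousLinearMap.adjoint L v) (U i - U₀)| + _ < η
  linarith

lemma tendstoWeaklyW12_of_bounded {u du : ℝ → AddCircle T → ℝ} {u₀ du₀ : AddCircle T → ℝ}
    {l : Filter ℝ} {C D : ℝ} {s : ℝ → ℝ}
    (hu : ∀ᶠ ε in l, IsPrimitive (u ε) (du ε) ∧ MemLp (du ε) 2 volume ∧
      ∫ x, u ε x ^ 2 ≤ C ∧ ∫ x, du ε x ^ 2 ≤ D ∧ ∀ x, |u ε x - u₀ x| ≤ s ε)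
    (hu₀ : IsPrimitive u₀ du₀) (hdu₀ : MemLp du₀ 2 volume) (hs : Tendsto s l (𝓝 0)) :
    TendstoWeaklyW12 u l u₀ := by
  classical
  have hm₀ := DensityEquation.memLp_of_continuous hu₀.continuous 2
  -- The value `0` only fills in those `ε` for which `u ε` is not known to lie in the space; these
  -- are eventually absent.
  let U : ℝ → W12 T := fun ε =>
    if h : HasWeakDeriv (u ε) (du ε) ∧ MemLp (u ε) 2 volume ∧ MemLp (du ε) 2 volume then
      mkW12 h.1 h.2.1 h.2.2 else 0
  let U₀ : W12 T := mkW12 hu₀.hasWeakDeriv hm₀ hdu₀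
  have hUe : ∀ᶠ ε in l, ∃ (h1 : HasWeakDeriv (u ε) (du ε)) (h2 : MemLp (u ε) 2 volume)
      (h3 : MemLp (du ε) 2 volume), U ε = mkW12 h1 h2 h3 := by
    filter_upwards [hu] with ε hε
    have h2 := DensityEquation.memLp_of_continuous hε.1.continuous 2
    exact ⟨hε.1.hasWeakDeriv, h2, hε.2.1, dif_pos ⟨hε.1.hasWeakDeriv, h2, hε.2.1⟩⟩
  have hfst : Tendsto (fun ε => toL2 T (U ε)) l (𝓝 (toL2 T U₀)) := by
    rw [tendsto_iff_norm_sub_tendsto_zero]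
    have hs' : Tendsto (fun ε => √(s ε ^ 2 * T)) l (𝓝 0) := by
      have := ((hs.pow 2).mul_const T).sqrt
      simpa using this
    refine squeeze_zero' (Eventually.of_forall fun _ => norm_nonneg _) ?_ hs'
    filter_upwards [hUe, hu] with ε ⟨h1, h2, h3, he⟩ hε
    rw [he]
    have e : toL2 T (mkW12 h1 h2 h3) - toL2 T U₀ = (h2.sub hm₀).toLp _ := rfl
    rw [e, Lp.norm_toLp]
    have hc : Continuous fun x => u ε x - u₀ x := hε.1.continuous.sub hu₀.continuous
    have hle : ∫ x, (u ε - u₀) x ^ 2 ≤ s ε ^ 2 * T := by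
      have h4 : ∫ x, (u ε x - u₀ x) ^ 2 ≤ ∫ _ : AddCircle T, s ε ^ 2 :=
        integral_mono (integrable_of_continuous (hc.pow 2) _) (integrable_const _) fun x => by
          have := hε.2.2.2.2 x
          simp only
          rw [← sq_abs]
          gcongr
      rw [integral_const, measureReal_univ, smul_eq_mul, mul_comm] at h4
      exact h4
    have h5 := ENNReal.toReal_mono ENNReal.ofReal_ne_top (eLpNorm_two_le (h2.sub hm₀) hle)
    rwa [ENNReal.toReal_ofReal (Real.sqrt_nonneg _)] at h5
  have hR : ∀ᶠ ε in l, ‖U ε - U₀‖ ≤ √(C + D) + ‖U₀‖ := by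
    filter_upwards [hUe, hu] with ε ⟨h1, h2, h3, he⟩ hε
    refine (norm_sub_le _ _).trans (add_le_add ?_ le_rfl)
    rw [he]
    exact norm_mkW12_le h1 h2 h3 hε.2.2.1 hε.2.2.2.1
  refine ⟨U, U₀, ?_, MemLp.coeFn_toLp hm₀, ?_⟩
  · filter_upwards [hUe] with ε ⟨h1, h2, h3, he⟩
    rw [he]
    exact MemLp.coeFn_toLp h2
  · have hinj : Function.Injective (topDualPairing ℝ (W12 T)).flip := by
      intro x y hxy
      refine ext_inner_left ℝ fun w => ?_
      exact LinearMap.congr_fun hxy (InnerProductSpace.toDual ℝ (W12 T) w)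
    refine (WeakBilin.tendsto_iff_forall_eval_tendsto _ hinj).2 fun y => ?_
    have h1 := tendsto_inner_of_injective (toL2 T) toL2_injective hR hfst
      ((InnerProductSpace.toDual ℝ (W12 T)).symm y)
    simp only [InnerProductSpace.toDual_symm_apply] at h1
    exact h1

/-! ### From stationary measures to the density equation -/

lemma generator_eq {T : ℝ} {m : ℕ} (B : AddCircle T → ℝ) (A : Fin (m + 1) → AddCircle T → ℝ)
    (dA : Fin m → AddCircle T → ℝ) (ε : ℝ) (f : AddCircle T → ℝ) (x : AddCircle T) :
    generator B A dA ε f x =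
      (ε ^ 2 / 2 * ∑ i : Fin m, A i.succ x ^ 2) * circleDeriv (circleDeriv f) x +
      (ε ^ 2 / 2 * ∑ i : Fin m, A i.succ x * dA i x + ε ^ 2 * A 0 x + B x) * circleDeriv f x := by
  have e : ∑ i : Fin m, A i.succ x *
      (A i.succ x * circleDeriv (circleDeriv f) x + dA i x * circleDeriv f x) =
      (∑ i : Fin m, A i.succ x ^ 2) * circleDeriv (circleDeriv f) x +
      (∑ i : Fin m, A i.succ x * dA i x) * circleDeriv f x := by
    rw [Finset.sum_mul, Finset.sum_mul, ← Finset.sum_add_distrib]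
    refine Finset.sum_congr rfl fun i _ => ?_
    ring
  rw [generator, e]
  ring

/-- With `P = ε² a u` and `a' = ∑ Aᵢ Aᵢ'`, the Stratonovich correction in the drift cancels half of
`a' u`. The rest, together with `A₀`, forms `β = ½ ∑ Aᵢ Aᵢ' - A₀`. -/
lemma exists_densityEquation {m : ℕ} {B dB : AddCircle T → ℝ} {b₀ b₁ K a₀ a₁ N ε : ℝ}
    (hB : IsPrimitive B dB) (hb₀ : 0 < b₀) (hB₀ : ∀ x, b₀ ≤ B x) (hB₁ : ∀ x, B x ≤ b₁)
    (hdB : Measurable dB) (hK : ∀ x, |dB x| ≤ K) (hε : 0 < ε)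
    {A : Fin (m + 1) → AddCircle T → ℝ} (hAc : ∀ i : Fin m, Continuous (A i.succ))
    (ha₀ : 0 < a₀) (ha₀A : ∀ x, a₀ ≤ 1 / 2 * ∑ i : Fin m, A i.succ x ^ 2)
    (ha₁A : ∀ x, 1 / 2 * ∑ i : Fin m, A i.succ x ^ 2 ≤ a₁)
    (hβ : ∀ dA : Fin m → AddCircle T → ℝ, (∀ i, HasWeakDeriv (A i.succ) (dA i)) →
      MemLp (fun x => 1 / 2 * ∑ i : Fin m, A i.succ x * dA i x - A 0 x) 2 volume ∧
      ∫ x, (1 / 2 * ∑ i : Fin m, A i.succ x * dA i x - A 0 x) ^ 2 ≤ N)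
    {μ : Measure (AddCircle T)} (hμ : IsStationaryMeasure B A ε μ) :
    ∃ (a β : AddCircle T → ℝ) (κ : ℝ) (u du : AddCircle T → ℝ),
      DensityEquation B dB b₀ b₁ K a₀ a₁ N a β ε κ u du ∧
      μ = volume.withDensity fun x => ENNReal.ofReal (u x) := by
  obtain ⟨hprob, dA, hdA, hA0, hdAμ, hgen⟩ := hμ
  obtain ⟨hβ2, hβN⟩ := hβ dA hdA
  set S : AddCircle T → ℝ := fun x => ∑ i : Fin m, A i.succ x * dA i x with hS
  set Q : AddCircle T → ℝ := fun x => ∑ i : Fin m, A i.succ x ^ 2 with hQ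
  have hAp : ∀ i : Fin m, IsPrimitive (A i.succ) (dA i) := fun i => (hdA i).isPrimitive (hAc i)
  have hQp : IsPrimitive Q (fun x => 2 * S x) := by
    have h1 := IsPrimitive.sum Finset.univ (F := fun (i : Fin m) x => A i.succ x * A i.succ x)
      (f := fun (i : Fin m) x => dA i x * A i.succ x + A i.succ x * dA i x)
      fun i _ => (hAp i).mul (hAp i)
    have e1 : Q = fun x => ∑ i : Fin m, A i.succ x * A i.succ x := by
      funext x
      exact Finset.sum_congr rfl fun i _ => sq _
    have e2 : (fun x => 2 * S x) =
        fun x => ∑ i : Fin m, (dA i x * A i.succ x + A i.succ x * dA i x) := by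
      funext x
      rw [hS, Finset.mul_sum]
      refine Finset.sum_congr rfl fun i _ => ?_
      ring
    rwa [e1, e2]
  have hap : IsPrimitive (fun x => ε ^ 2 / 2 * Q x) (fun x => ε ^ 2 / 2 * (2 * S x)) :=
    hQp.const_mul _
  have halow : ∀ x, ε ^ 2 * a₀ ≤ ε ^ 2 / 2 * Q x := fun x => by
    have h1 : ε ^ 2 * a₀ ≤ ε ^ 2 * (1 / 2 * Q x) := mul_le_mul_of_nonneg_left (ha₀A x) (sq_nonneg ε)
    linarith
  have hεa : 0 < ε ^ 2 * a₀ := by positivity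
  have hapos : ∀ x, 0 < ε ^ 2 / 2 * Q x := fun x => hεa.trans_le (halow x)
  have hbI : Integrable (fun x => ε ^ 2 / 2 * S x + ε ^ 2 * A 0 x + B x) μ := by
    refine ((Integrable.const_mul ?_ _).add (hA0.const_mul _)).add
      (integrable_of_continuous hB.continuous μ)
    exact integrable_finsetSum _ fun i _ => integrable_continuous_mul (hAc i) (hdAμ i)
  obtain ⟨P, κ, hP, hP0, hPμ⟩ := exists_density_of_stationary hap.continuous hapos hbI
    fun φ hφ h0 => by
      obtain ⟨f, hf, -⟩ := exists_isPrimitive (integrable_of_continuous hφ.continuous volume) h0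
      have h1 := hgen f (ContDiff.of_le (hf.isCn hφ) (by exact_mod_cast le_top))
      simp only [generator_eq, hf.circleDeriv_eq hφ.continuous] at h1
      exact h1
  have hu := hP.mul (hap.inv hεa halow)
  have hu0 : ∀ x, 0 ≤ P x * (ε ^ 2 / 2 * Q x)⁻¹ := fun x =>
    mul_nonneg (hP0 x) (inv_nonneg.2 (hapos x).le)
  have hμu : μ = volume.withDensity fun x => ENNReal.ofReal (P x * (ε ^ 2 / 2 * Q x)⁻¹) := by
    simpa only [div_eq_mul_inv (P _)] using hPμ
  refine ⟨fun x => 1 / 2 * Q x, fun x => 1 / 2 * S x - A 0 x, κ, _, _,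
    { isPrimitive_B := hB
      b₀_pos := hb₀
      le_B := hB₀
      B_le := hB₁
      measurable_dB := hdB
      abs_dB_le := hK
      continuous_a := continuous_const.mul hQp.continuous
      a₀_pos := ha₀
      le_a := ha₀A
      a_le := ha₁A
      memLp_β := hβ2
      integral_β_sq_le := hβN
      ε_pos := hε
      isPrimitive_u := hu
      u_nonneg := hu0
      integral_u := ?_
      eq := fun x => ?_ }, hμu⟩
  · have h1 : μ univ = 1 := hprob.measure_univ
    rw [hμu, withDensity_apply _ MeasurableSet.univ, Measure.restrict_univ,
      ← ofReal_integral_eq_lintegral_ofReal (integrable_of_continuous hu.continuous volume)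
        (Eventually.of_forall hu0)] at h1
    exact ENNReal.ofReal_eq_one.1 h1
  · have h1 : Q x ≠ 0 := fun h => by
      have := hapos x
      rw [h, mul_zero] at this
      exact this.false
    have h2 := hε.ne'
    field_simp
    ring

/-! ### Uniform bounds for admissible noise -/

lemma integral_sq_le_of_eLpNorm_le {f : AddCircle T → ℝ} (hf : MemLp f 2 volume) {c : ℝ≥0}
    (h : eLpNorm f 2 volume ≤ c) : ∫ x, f x ^ 2 ≤ (c : ℝ) ^ 2 := by
  rw [hf.eLpNorm_eq_integral_rpow_norm (by norm_num) (by norm_num)] at h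
  have e : ∀ x, ‖f x‖ ^ (2 : ℝ≥0∞).toReal = f x ^ 2 := fun x => by
    rw [ENNReal.toReal_ofNat, Real.rpow_ofNat, Real.norm_eq_abs, sq_abs]
  have e2 : (2 : ℝ≥0∞).toReal⁻¹ = 1 / 2 := by norm_num
  simp only [e, e2] at h
  rw [← Real.sqrt_eq_rpow, ENNReal.ofReal_le_iff_le_toReal ENNReal.coe_ne_top,
    ENNReal.coe_toReal] at h
  exact (Real.sqrt_le_left c.2).1 h

/-- The circle has finite length, so `L^p` bounds become `L²` bounds. The estimates use the
integrability exponent only through this. -/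
lemma memLp_two_of_eLpNorm_le {p : ℝ≥0∞} (hp : 2 ≤ p) (C : ℝ≥0) :
    ∃ c : ℝ≥0, ∀ f : AddCircle T → ℝ, AEStronglyMeasurable f volume → eLpNorm f p volume ≤ C →
      MemLp f 2 volume ∧ ∫ x, f x ^ 2 ≤ (c : ℝ) ^ 2 := by
  have hT : (0 : ℝ) < T := Fact.out
  set V : ℝ≥0∞ := (volume (univ : Set (AddCircle T))) ^ (1 / (2 : ℝ≥0∞).toReal - 1 / p.toReal)
    with hV
  have hVt : V ≠ ⊤ := by
    rw [hV, AddCircle.measure_univ]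
    exact ENNReal.rpow_ne_top_of_ne_zero (by simpa using hT) ENNReal.ofReal_ne_top
  refine ⟨C * V.toNNReal, fun f hf hfC => ?_⟩
  have h1 : eLpNorm f 2 volume ≤ (C * V.toNNReal : ℝ≥0) := by
    refine (eLpNorm_le_eLpNorm_mul_rpow_measure_univ hp hf).trans ?_
    rw [ENNReal.coe_mul, ENNReal.coe_toNNReal hVt]
    gcongr
  have h2 : MemLp f 2 volume := ⟨hf, h1.trans_lt ENNReal.coe_lt_top⟩
  exact ⟨h2, integral_sq_le_of_eLpNorm_le h2 h1⟩

lemma HasWeakDeriv.eLpNorm_add_le_w1Norm {f g : AddCircle T → ℝ} (h : HasWeakDeriv f g)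
    (p : ℝ≥0∞) : eLpNorm f p volume + eLpNorm g p volume ≤ w1Norm p f :=
  le_iInf₂ fun g' h' => by rw [eLpNorm_congr_ae (h.ae_unique h')]

/-- A bound for `|F|` in terms of `∫ F² ≤ N` and `∫ (F')² ≤ N`. -/
def sobolevConst (T N : ℝ) : ℝ := (T + N) / (2 * T) + (T + N) / 2

lemma IsPrimitive.abs_le_sobolevConst {F f : AddCircle T → ℝ} (h : IsPrimitive F f) {N : ℝ}
    (hf : Integrable (fun x => f x ^ 2) volume) (hFN : ∫ x, F x ^ 2 ≤ N)
    (hfN : ∫ x, f x ^ 2 ≤ N) (x : AddCircle T) : |F x| ≤ sobolevConst T N := by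
  have hT : (0 : ℝ) < T := Fact.out
  have hF : Integrable (fun x => F x ^ 2) volume :=
    integrable_of_continuous (h.continuous.pow 2) volume
  have hsq : ∀ r : ℝ, |r| ≤ 1 / 2 + 1 / 2 * r ^ 2 := fun r => by
    rw [← sq_abs r]
    nlinarith [sq_nonneg (|r| - 1)]
  have h1 : ∫ z, |f z| ≤ (T + N) / 2 := by
    have h2 : ∫ z, |f z| ≤ ∫ z, (1 / 2 + 1 / 2 * f z ^ 2) :=
      integral_mono h.integrable.abs ((integrable_const _).add (hf.const_mul _)) fun z => hsq _
    rw [integral_add (integrable_const _) (hf.const_mul _), integral_const, measureReal_univ,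
      integral_const_mul, smul_eq_mul] at h2
    linarith
  have h3 : ∫ _ : AddCircle T, |F x| ≤ ∫ y, ((1 / 2 + (T + N) / 2) + 1 / 2 * F y ^ 2) := by
    refine integral_mono (integrable_const _) ((integrable_const _).add (hF.const_mul _))
      fun y => ?_
    have h4 := h.abs_sub_le y x
    have h5 := abs_sub_abs_le_abs_sub (F x) (F y)
    have h6 := hsq (F y)
    simp only
    linarith
  rw [integral_add (integrable_const _) (hF.const_mul _), integral_const, integral_const,
    measureReal_univ, integral_const_mul, smul_eq_mul, smul_eq_mul] at h3
  have h7 : T * |F x| ≤ T * sobolevConst T N := by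
    have e : T * sobolevConst T N = (T + N) / 2 + T * ((T + N) / 2) := by
      rw [sobolevConst]
      field_simp
    have h8 : 1 / 2 * ∫ y, F y ^ 2 ≤ 1 / 2 * N := by gcongr
    linarith
  exact le_of_mul_le_mul_left h7 hT

lemma Admissible.exists_bounds {ε₀ : ℝ} {m : ℕ} {A : ℝ → Fin (m + 1) → AddCircle T → ℝ}
    (hA : Admissible ε₀ A) :
    ∃ a₀ a₁ N : ℝ, 0 < a₀ ∧ ∀ ε ∈ Ioo 0 ε₀,
      (∀ x, a₀ ≤ 1 / 2 * ∑ i : Fin m, A ε i.succ x ^ 2) ∧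
      (∀ x, 1 / 2 * ∑ i : Fin m, A ε i.succ x ^ 2 ≤ a₁) ∧
      ∀ dA : Fin m → AddCircle T → ℝ, (∀ i, HasWeakDeriv (A ε i.succ) (dA i)) →
        MemLp (fun x => 1 / 2 * ∑ i : Fin m, A ε i.succ x * dA i x - A ε 0 x) 2 volume ∧
        ∫ x, (1 / 2 * ∑ i : Fin m, A ε i.succ x * dA i x - A ε 0 x) ^ 2 ≤ N := by
  obtain ⟨p, hp, hmem, C, hC⟩ := hA.regular
  obtain ⟨c, hc0, hc⟩ := hA.nondegenerate
  obtain ⟨c₂, hc₂⟩ := memLp_two_of_eLpNorm_le (T := T) hp.le C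
  set M : ℝ := (c₂ : ℝ) ^ 2 with hM
  have hM0 : 0 ≤ M := sq_nonneg _
  have hi : ∀ ε ∈ Ioo 0 ε₀, ∀ (i : Fin m) (g : AddCircle T → ℝ), HasWeakDeriv (A ε i.succ) g →
      MemLp g 2 volume ∧ ∫ x, g x ^ 2 ≤ M ∧ ∀ x, |A ε i.succ x| ≤ sobolevConst T M := by
    intro ε hε i g hg
    have h1 : eLpNorm (A ε i.succ) p volume + eLpNorm g p volume ≤ C :=
      (hg.eLpNorm_add_le_w1Norm p).trans ((le_iSup (fun i : Fin m => w1Norm p (A ε i.succ)) i).trans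
        (le_add_self.trans (hC ε hε)))
    have h2 := hc₂ _ hg.integrable_left.1 (le_self_add.trans h1)
    have h3 := hc₂ _ hg.integrable_right.1 (le_add_self.trans h1)
    exact ⟨h3.1, h3.2, (hg.isPrimitive (hA.continuous ε hε i)).abs_le_sobolevConst
      h3.1.integrable_sq h2.2 h3.2⟩
  have h0 : ∀ ε ∈ Ioo 0 ε₀, MemLp (A ε 0) 2 volume ∧ ∫ x, A ε 0 x ^ 2 ≤ M := fun ε hε =>
    hc₂ _ (hmem ε hε).1.1 (le_self_add.trans (hC ε hε))
  set S := sobolevConst T M with hS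
  -- `S` bounds each `|Aᵢ|` by the one-dimensional Sobolev inequality and `M` bounds the `L²` norms
  -- squared. The third constant comes from `(s / 2 - A₀)² ≤ s² / 2 + 2 A₀²` and Cauchy-Schwarz for
  -- the sum `s = ∑ Aᵢ Aᵢ'`.
  refine ⟨c / 2, 1 / 2 * (m * S ^ 2), 1 / 2 * (m * S ^ 2 * (m * M)) + 2 * M, by positivity,
    fun ε hε => ⟨fun x => ?_, fun x => ?_, fun dA hdA => ?_⟩⟩
  · have := hc ε hε x
    simp only [sq_abs] at this
    linarith
  · have h1 : ∑ i : Fin m, A ε i.succ x ^ 2 ≤ ∑ _ : Fin m, S ^ 2 := by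
      refine Finset.sum_le_sum fun i _ => ?_
      obtain ⟨-, g, hg, -⟩ := (hmem ε hε).2 i
      have h2 := (hi ε hε i g hg).2.2 x
      rw [← sq_abs]
      gcongr
    rw [Finset.sum_const, Finset.card_univ, Fintype.card_fin, nsmul_eq_mul] at h1
    linarith
  · have hd := fun i => hi ε hε i (dA i) (hdA i)
    have h0' := h0 ε hε
    have hsum : MemLp (fun x => ∑ i : Fin m, A ε i.succ x * dA i x) 2 volume :=
      memLp_finsetSum _ fun i _ =>
        DensityEquation.memLp_continuous_mul (hA.continuous ε hε i) (hd i).1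
    have hβ : MemLp (fun x => 1 / 2 * ∑ i : Fin m, A ε i.succ x * dA i x - A ε 0 x) 2 volume :=
      (hsum.const_mul (1 / 2)).sub h0'.1
    refine ⟨hβ, ?_⟩
    have hI1 : Integrable (fun x => ∑ i : Fin m, dA i x ^ 2) volume :=
      integrable_finsetSum _ fun i _ => (hd i).1.integrable_sq
    have hI2 := h0'.1.integrable_sq
    have h1 : ∫ x, (1 / 2 * ∑ i : Fin m, A ε i.succ x * dA i x - A ε 0 x) ^ 2 ≤
        ∫ x, (1 / 2 * (m * S ^ 2) * ∑ i : Fin m, dA i x ^ 2 + 2 * A ε 0 x ^ 2) := by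
      refine integral_mono hβ.integrable_sq ((hI1.const_mul _).add (hI2.const_mul _)) fun x => ?_
      simp only
      have h2 : (∑ i : Fin m, A ε i.succ x * dA i x) ^ 2 ≤
          m * ∑ i : Fin m, (A ε i.succ x * dA i x) ^ 2 := by
        simpa using sq_sum_le_card_mul_sum_sq (s := Finset.univ)
          (f := fun i : Fin m => A ε i.succ x * dA i x)
      have h3 : ∑ i : Fin m, (A ε i.succ x * dA i x) ^ 2 ≤ S ^ 2 * ∑ i : Fin m, dA i x ^ 2 := by
        rw [Finset.mul_sum]
        refine Finset.sum_le_sum fun i _ => ?_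
        rw [mul_pow, ← sq_abs (A ε i.succ x)]
        have := (hd i).2.2 x
        gcongr
      have h4 : (m : ℝ) * ∑ i : Fin m, (A ε i.succ x * dA i x) ^ 2 ≤
          m * (S ^ 2 * ∑ i : Fin m, dA i x ^ 2) := by gcongr
      set s := ∑ i : Fin m, A ε i.succ x * dA i x
      nlinarith [sq_nonneg (1 / 2 * s + A ε 0 x)]
    refine h1.trans ?_
    rw [integral_add (hI1.const_mul _) (hI2.const_mul _), integral_const_mul, integral_const_mul,
      integral_finsetSum _ fun i _ => (hd i).1.integrable_sq]
    have h5 : ∑ i : Fin m, ∫ x, dA i x ^ 2 ≤ m * M := by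
      refine (Finset.sum_le_sum fun i _ => (hd i).2.1).trans ?_
      simp
    have h6 := h0'.2
    have h7 : 1 / 2 * (m * S ^ 2) * ∑ i : Fin m, ∫ x, dA i x ^ 2 ≤
        1 / 2 * (m * S ^ 2) * (m * M) := by gcongr
    linarith

/-! ### Uniform bounds and convergence of a family of densities -/

namespace DensityEquation

variable {B dB : AddCircle T → ℝ} {b₀ b₁ K a₀ a₁ N : ℝ} {a β : AddCircle T → ℝ} {ε κ : ℝ}
  {u du : AddCircle T → ℝ}

lemma integral_u_sq_le (h : DensityEquation B dB b₀ b₁ K a₀ a₁ N a β ε κ u du) :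
    ∫ x, u x ^ 2 ≤ supConst T b₀ b₁ K a₀ a₁ N ^ 2 * T := by
  have h1 : ∫ x, u x ^ 2 ≤ ∫ _ : AddCircle T, supConst T b₀ b₁ K a₀ a₁ N ^ 2 :=
    integral_mono (integrable_of_continuous (h.isPrimitive_u.continuous.pow 2) _)
      (integrable_const _) fun x => by
        have h2 := h.u_nonneg x
        have h3 := h.u_le x
        simp only
        gcongr
  rwa [integral_const, measureReal_univ, smul_eq_mul, mul_comm] at h1

lemma w1Norm_le (h : DensityEquation B dB b₀ b₁ K a₀ a₁ N a β ε κ u du) :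
    MemW1 2 u ∧ w1Norm 2 u ≤ ((√(supConst T b₀ b₁ K a₀ a₁ N ^ 2 * T)).toNNReal +
      (√(dirichletConst T b₀ b₁ K a₀ a₁ N)).toNNReal : ℝ≥0) := by
  have hw := h.isPrimitive_u.hasWeakDeriv
  have hu := memLp_of_continuous h.isPrimitive_u.continuous 2
  refine ⟨⟨hu, du, hw, h.memLp_du⟩, (iInf₂_le du hw).trans ?_⟩
  rw [ENNReal.coe_add]
  exact add_le_add (eLpNorm_two_le hu h.integral_u_sq_le)
    (eLpNorm_two_le h.memLp_du h.integral_du_sq_le_dirichletConst)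

/-- The constant in the estimate `|u - u₀| ≤ C ε`. -/
def limitConst (T b₀ b₁ K a₀ a₁ N ε₀ : ℝ) : ℝ :=
  2 * √(rateConst T b₀ b₁ K a₀ a₁ N ε₀) / b₀

/-- For `ε ≤ ε₁` the density is within `γ / (2 b₁)` of a limit that is at least `γ / b₁`. For `ε ≥
ε₁` the equation is uniformly non-degenerate and the Harnack bound applies. -/
lemma exists_pos_le (hB : Continuous B) (hb₀ : 0 < b₀) (hB₀ : ∀ x, b₀ ≤ B x)
    (hB₁ : ∀ x, B x ≤ b₁) (ε₀ : ℝ) :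
    ∃ c : ℝ, 0 < c ∧ ∀ {a β : AddCircle T → ℝ} {ε κ : ℝ} {u du : AddCircle T → ℝ},
      DensityEquation B dB b₀ b₁ K a₀ a₁ N a β ε κ u du → ε ≤ ε₀ → ∀ x, c ≤ u x := by
  have hT : (0 : ℝ) < T := Fact.out
  have hBpos : ∀ y, 0 < B y := fun y => hb₀.trans_le (hB₀ y)
  have hb₁ : 0 < b₁ := (hBpos 0).trans_le (hB₁ 0)
  have hI : 0 < ∫ y, 1 / B y := by
    have h1 : ∫ _ : AddCircle T, 1 / b₁ ≤ ∫ y, 1 / B y :=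
      integral_mono (integrable_const _)
        (integrable_of_continuous (continuous_const.div hB fun y => (hBpos y).ne') _)
        fun y => one_div_le_one_div_of_le (hBpos y) (hB₁ y)
    rw [integral_const, measureReal_univ, smul_eq_mul] at h1
    have h2 : 0 < T * (1 / b₁) := by positivity
    linarith
  set γ := (∫ y, 1 / B y)⁻¹ with hγ
  have hγ0 : 0 < γ := inv_pos.2 hI
  set r := limitConst T b₀ b₁ K a₀ a₁ N ε₀ with hr
  have hr0 : 0 ≤ r := by
    rw [hr, limitConst]
    positivity
  -- Chosen so that `r ε₁ ≤ γ / (2 b₁)`; the added `1` covers `r = 0`.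
  set ε₁ := γ / b₁ / 2 / (r + 1) with hε₁
  have hε₁0 : 0 < ε₁ := by positivity
  refine ⟨min (γ / b₁ / 2) (Real.exp (-harnackConst T b₁ a₀ N ε₁) / T),
    lt_min (by positivity) (by positivity), fun {a β ε κ u du} h hε x => ?_⟩
  rcases le_total ε₁ ε with hle | hle
  · exact (min_le_right _ _).trans (h.exp_neg_harnackConst_le hε₁0 hle x)
  · refine (min_le_left _ _).trans ?_
    have h1 := (abs_le.1 (h.abs_sub_limit_le hε x)).1
    have h2 : γ / b₁ ≤ γ / B x := by
      have := hBpos x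
      have := hB₁ x
      gcongr
    have h3 : r * ε ≤ γ / b₁ / 2 := by
      have h4 : (r + 1) * ε₁ = γ / b₁ / 2 := by
        rw [hε₁]
        field_simp
      have h5 := h.ε_pos
      nlinarith
    change -(r * ε) ≤ u x - γ / B x at h1
    linarith

end DensityEquation

lemma isPrimitive_const_div {B dB : AddCircle T → ℝ} (hB : IsPrimitive B dB) {b₀ : ℝ}
    (hb₀ : 0 < b₀) (hB₀ : ∀ x, b₀ ≤ B x) (hdB : MemLp dB 2 volume) (γ : ℝ) :
    ∃ d : AddCircle T → ℝ, IsPrimitive (fun x => γ / B x) d ∧ MemLp d 2 volume := by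
  have h1 := (hB.inv hb₀ hB₀).const_mul γ
  refine ⟨_, by simpa only [div_eq_mul_inv] using h1, ?_⟩
  refine MemLp.const_mul (DensityEquation.memLp_continuous_mul ?_ hdB) γ
  refine ((hB.continuous.pow 2).inv₀ fun x => ?_).neg
  exact pow_ne_zero 2 (hb₀.trans_le (hB₀ x)).ne'

lemma tendsto_holder_bound {α : ℝ≥0} (hα : α < 1 / 2) (r : ℝ) (D : ℝ≥0) :
    Tendsto (fun ε : ℝ => (((r * ε).toNNReal : ℝ≥0∞) +
      ((2 * (r * ε)).toNNReal ^ ((1 - 2 * α : ℝ≥0) : ℝ) * D : ℝ≥0))) (𝓝[>] 0) (𝓝 0) := by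
  have hexp : (0 : ℝ) < ((1 - 2 * α : ℝ≥0) : ℝ) := by
    rw [NNReal.coe_pos, tsub_pos_iff_lt]
    have : 2 * α < 2 * (1 / 2) := by gcongr
    simpa using this
  have hc : Tendsto (fun ε : ℝ => (r * ε).toNNReal +
      (2 * (r * ε)).toNNReal ^ ((1 - 2 * α : ℝ≥0) : ℝ) * D) (𝓝 0)
      (𝓝 ((r * 0).toNNReal + (2 * (r * 0)).toNNReal ^ ((1 - 2 * α : ℝ≥0) : ℝ) * D)) := by
    refine Continuous.tendsto (f := fun ε : ℝ => (r * ε).toNNReal +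
      (2 * (r * ε)).toNNReal ^ ((1 - 2 * α : ℝ≥0) : ℝ) * D) ?_ 0
    have h1 : Continuous fun x : ℝ≥0 => x ^ ((1 - 2 * α : ℝ≥0) : ℝ) :=
      NNReal.continuous_rpow_const hexp.le
    have h2 : Continuous fun ε : ℝ => (2 * (r * ε)).toNNReal :=
      continuous_real_toNNReal.comp (by fun_prop)
    have h3 : Continuous fun ε : ℝ => (r * ε).toNNReal :=
      continuous_real_toNNReal.comp (by fun_prop)
    exact h3.add ((h1.comp h2).mul continuous_const)
  have h0 : (r * 0).toNNReal + (2 * (r * 0)).toNNReal ^ ((1 - 2 * α : ℝ≥0) : ℝ) * D = 0 := by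
    simp [NNReal.zero_rpow hexp.ne']
  rw [h0] at hc
  have := (ENNReal.tendsto_coe.2 hc).mono_left (nhdsWithin_le_nhds (s := Ioi (0 : ℝ)))
  simpa only [ENNReal.coe_add, ENNReal.coe_zero] using this

end Circle1D

end

/-! ### Uniform bounds and convergence of the stationary densities -/

theorem theorem4p1 {T : ℝ} [Fact (0 < T)] {B : AddCircle T → ℝ}
    (hBlip : ∃ K : ℝ≥0, LipschitzWith K B) (hBpos : ∀ x, 0 < B x)
    {ε₀ : ℝ} (hε₀ : 0 < ε₀) {m : ℕ} (hm : 1 ≤ m)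
    {A : ℝ → Fin (m + 1) → AddCircle T → ℝ} (hA : Circle1D.Admissible ε₀ A)
    {μ : ℝ → Measure (AddCircle T)}
    (hμ : ∀ ε ∈ Ioo 0 ε₀, Circle1D.IsStationaryMeasure B (A ε) ε (μ ε)) :
    ∃ u : ℝ → AddCircle T → ℝ,
      (∀ ε ∈ Ioo 0 ε₀, Continuous (u ε) ∧
        μ ε = volume.withDensity (fun x => ENNReal.ofReal (u ε x))) ∧
      (∃ C : ℝ≥0, ∀ ε ∈ Ioo 0 ε₀,
        Circle1D.MemW1 2 (u ε) ∧ Circle1D.w1Norm 2 (u ε) ≤ C) ∧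
      (∃ c C : ℝ, 0 < c ∧ ∀ ε ∈ Ioo 0 ε₀, ∀ x, c ≤ u ε x ∧ u ε x ≤ C) ∧
      Circle1D.TendstoWeaklyW12 u (𝓝[>] 0) (fun x => (∫ y, 1 / B y)⁻¹ / B x) ∧
      ∀ α : ℝ≥0, 0 < α → α < 1 / 2 →
        Tendsto (fun ε => Circle1D.cAlphaNorm α (fun x => u ε x - (∫ y, 1 / B y)⁻¹ / B x))
          (𝓝[>] 0) (𝓝 0) := by

  obtain ⟨K, hK⟩ := hBlip
  obtain ⟨hdBm, hdBK, hBp⟩ := Circle1D.IsPrimitive.of_lipschitzWith hK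
  have hBc := hBp.continuous
  obtain ⟨z₀, -, hz₀⟩ := isCompact_univ.exists_isMinOn univ_nonempty hBc.continuousOn
  obtain ⟨z₁, -, hz₁⟩ := isCompact_univ.exists_isMaxOn univ_nonempty hBc.continuousOn
  have hB₀ : ∀ x, B z₀ ≤ B x := fun x => hz₀ (mem_univ x)
  have hB₁ : ∀ x, B x ≤ B z₁ := fun x => hz₁ (mem_univ x)
  obtain ⟨a₀, a₁, N, ha₀, hbd⟩ := hA.exists_bounds
  have key : ∀ ε ∈ Ioo 0 ε₀, ∃ (a β : AddCircle T → ℝ) (κ : ℝ) (u du : AddCircle T → ℝ),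
      Circle1D.DensityEquation B (Circle1D.circleDeriv B) (B z₀) (B z₁) K a₀ a₁ N a β ε κ u du ∧
      μ ε = volume.withDensity fun x => ENNReal.ofReal (u x) := fun ε hε =>
    Circle1D.exists_densityEquation hBp (hBpos z₀) hB₀ hB₁ hdBm hdBK hε.1 (hA.continuous ε hε) ha₀
      (hbd ε hε).1 (hbd ε hε).2.1 (hbd ε hε).2.2 (hμ ε hε)
  choose! a β κ u du hE hμu using key
  have hdB2 : MemLp (Circle1D.circleDeriv B) 2 volume :=
    MemLp.of_bound hdBm.aestronglyMeasurable K (Eventually.of_forall hdBK)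
  obtain ⟨d, hd, hd2⟩ := Circle1D.isPrimitive_const_div hBp (hBpos z₀) hB₀ hdB2 (∫ y, 1 / B y)⁻¹
  obtain ⟨c, hc0, hc⟩ := Circle1D.DensityEquation.exists_pos_le (dB := Circle1D.circleDeriv B) (K := K) (a₀ := a₀)
    (a₁ := a₁) (N := N) hBc (hBpos z₀) hB₀ hB₁ ε₀
  set r := Circle1D.DensityEquation.limitConst T (B z₀) (B z₁) K a₀ a₁ N ε₀ with hr
  set D := Circle1D.DensityEquation.dirichletConst T (B z₀) (B z₁) K a₀ a₁ N with hD
  have hmem : ∀ᶠ ε : ℝ in 𝓝[>] 0, ε ∈ Ioo 0 ε₀ := Ioo_mem_nhdsGT hε₀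
  have hrate : ∀ ε ∈ Ioo 0 ε₀, ∀ x, |u ε x - (∫ y, 1 / B y)⁻¹ / B x| ≤ r * ε := fun ε hε =>
    (hE ε hε).abs_sub_limit_le hε.2.le
  refine ⟨u, fun ε hε => ⟨(hE ε hε).isPrimitive_u.continuous, hμu ε hε⟩,
    ⟨_, fun ε hε => (hE ε hε).w1Norm_le⟩,
    ⟨c, _, hc0, fun ε hε x => ⟨hc (hE ε hε) hε.2.le x, (hE ε hε).u_le x⟩⟩, ?_, fun α _ hα => ?_⟩
  · have hs : Tendsto (fun ε : ℝ => r * ε) (𝓝[>] 0) (𝓝 0) := by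
      have : Tendsto (fun ε : ℝ => r * ε) (𝓝 0) (𝓝 (r * 0)) :=
        (continuous_const.mul continuous_id).tendsto 0
      rw [mul_zero] at this
      exact this.mono_left nhdsWithin_le_nhds
    refine Circle1D.tendstoWeaklyW12_of_bounded (du := du)
      (C := Circle1D.DensityEquation.supConst T (B z₀) (B z₁) K a₀ a₁ N ^ 2 * T) (D := D) ?_ hd hd2 hs
    filter_upwards [hmem] with ε hε
    exact ⟨(hE ε hε).isPrimitive_u, (hE ε hε).memLp_du, (hE ε hε).integral_u_sq_le,
      (hE ε hε).integral_du_sq_le_dirichletConst, hrate ε hε⟩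
  · refine tendsto_of_tendsto_of_tendsto_of_le_of_le' tendsto_const_nhds
      -- The quantity under the root bounds the Dirichlet energy of `u ε - u₀`, by `(p - q)² ≤ 2 p²
      -- + 2 q²`. It stays bounded while the uniform distance `r ε` tends to zero.
      (Circle1D.tendsto_holder_bound hα r ((√(2 * D + 2 * ∫ x, d x ^ 2)).toNNReal ^ ((2 * α : ℝ≥0) : ℝ)))
      (Eventually.of_forall fun _ => zero_le) ?_
    filter_upwards [hmem] with ε hε
    have hdu := (hE ε hε).memLp_du
    refine ((hE ε hε).isPrimitive_u.sub hd).cAlphaNorm_le (hdu.sub hd2).integrable_sq ?_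
      (hrate ε hε) hα
    have h1 : ∫ x, (du ε x - d x) ^ 2 ≤ ∫ x, (2 * du ε x ^ 2 + 2 * d x ^ 2) :=
      integral_mono (hdu.sub hd2).integrable_sq
        ((hdu.integrable_sq.const_mul _).add (hd2.integrable_sq.const_mul _)) fun x => by
          simp only
          nlinarith [sq_nonneg (du ε x + d x)]
    rw [integral_add (hdu.integrable_sq.const_mul _) (hd2.integrable_sq.const_mul _),
      integral_const_mul, integral_const_mul] at h1
    have h2 := (hE ε hε).integral_du_sq_le_dirichletConst
    linarith
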